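/- **Setting.** A convex body in $\mathbb{R}^2$ is a nonempty compact convex set. It is a $C^2_+$ body if it is strictly convex and its boundary is a simple closed regular $C^2$ curve with nowhere vanishing curvature. For a convex body $M\subset\mathbb{R}^2$ let $h(\theta,M)=\max_{x\in M}(\cos\theta,\sin\theta)\cdot x$ be its support function, with Fourier coefficients $c_n(M)=\frac{1}{2\pi}\int_{-\pi}^{\pi}h(\theta,M)e^{-in\theta}\,d\theta$, $n\in\mathbb{Z}$, and let its excluded area function be $Ex(\cdot,M):\mathrm{SO}(2)\to\mathbb{R}$, $Ex(R,M)=|M-RM|$, the Lebesgue measure of $\{x-Ry: x,y\in M\}$. A rigid motion is a map $x\mapsto Rx+v$ with $R\in\mathrm{SO}(2)$ and $v\in\mathbb{R}^2$. **Theorem.** 1. Let $M,\tilde M$ be $C^2_+$ bodies in $\mathbb{R}^2$. Then $Ex(\cdot,M)=Ex(\cdot,\tilde M)$ if and only if $|c_n(M)|=|c_n(\tilde M)|$ for all $n\in\mathbb{Z}\setminus\{1,-1\}$. 2. Let $M$ be a $C^2_+$ body in $\mathbb{R}^2$. Then there exists a convex body $\tilde M$ which is not the image of $M$ under a rigid motion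 and satisfies $Ex(\cdot,M)=Ex(\cdot,\tilde M)$ if and only if there are integers $n>m\ge 2$ with $c_m(M)\ne 0$ and $c_n(M)\neq 0$. The same equivalence holds if reflections are also counted as rigid motions, i.e. if $R$ ranges over $\mathrm{O}(2)$. -/

import Mathlib

open scoped Pointwise

noncomputable section

/-- The Euclidean plane `ℝ²`. -/
abbrev Plane : Type := EuclideanSpace ℝ (Fin 2)

/-- The unit vector `u_θ = (cos θ, sin θ)`. -/
def unitVec (θ : ℝ) : Plane := !₂[Real.cos θ, Real.sin θ]

/-- The action of a `2 × 2` matrix on the plane. -/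
def matAct (R : Matrix (Fin 2) (Fin 2) ℝ) (x : Plane) : Plane :=
  Matrix.toEuclideanCLM (n := Fin 2) (𝕜 := ℝ) R x

/-- The support function `h(θ, M) = max_{x ∈ M} u_θ · x` of a (nonempty, compact) convex body. -/
def supportFn (M : ConvexBody Plane) (θ : ℝ) : ℝ :=
  sSup ((fun x : Plane => inner ℝ (unitVec θ) x) '' (M : Set Plane))

/-- The `n`-th Fourier coefficient
`c_n = (2π)⁻¹ ∫_{-π}^{π} h(θ, M) e^{-inθ} dθ` of the support function of `M`. -/
def supportCoeff (M : ConvexBody Plane) (n : ℤ) : ℂ :=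
  fourierCoeffOn (neg_lt_self Real.pi_pos) (fun θ : ℝ => (supportFn M θ : ℂ)) n

/-- The excluded area function `Ex(R, M) = |M - R M|`, `R ∈ SO(2)`, where `M - R M` is the
Minkowski difference `{x - R y : x, y ∈ M}` and `|·|` is Lebesgue measure. -/
def excludedArea (M : ConvexBody Plane) (R : Matrix.specialOrthogonalGroup (Fin 2) ℝ) : ℝ :=
  MeasureTheory.volume.real
    ((M : Set Plane) - matAct (R : Matrix (Fin 2) (Fin 2) ℝ) '' (M : Set Plane))

/-- The signed curvature `(γ₁' γ₂'' - γ₂' γ₁'') / |γ'|³` of a plane curve. -/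
def signedCurvature (γ : ℝ → Plane) (t : ℝ) : ℝ :=
  (deriv γ t 0 * deriv (deriv γ) t 1 - deriv γ t 1 * deriv (deriv γ) t 0) / ‖deriv γ t‖ ^ 3

/-- `C²₊` bodies: strictly convex bodies whose boundary is a simple closed regular `C²` curve
with nowhere vanishing curvature. -/
def IsC2Plus (M : ConvexBody Plane) : Prop :=
  StrictConvex ℝ (M : Set Plane) ∧
    ∃ (L : ℝ) (γ : ℝ → Plane), 0 < L ∧ ContDiff ℝ 2 γ ∧ Function.Periodic γ L ∧
      Set.InjOn γ (Set.Ico 0 L) ∧ Set.range γ = frontier (M : Set Plane) ∧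
      (∀ t, deriv γ t ≠ 0) ∧ ∀ t, signedCurvature γ t ≠ 0

/-- `M'` is the image of `M` under an orientation-preserving rigid motion
`x ↦ R x + v`, `R ∈ SO(2)`. -/
def IsRigidMotionOf (M' M : ConvexBody Plane) : Prop :=
  ∃ R ∈ Matrix.specialOrthogonalGroup (Fin 2) ℝ, ∃ v : Plane,
    (M' : Set Plane) = (fun x => matAct R x + v) '' (M : Set Plane)

/-- `M'` is congruent to `M`: the image of `M` under a rigid motion, reflections allowed,
`x ↦ R x + v`, `R ∈ O(2)`. -/
def IsCongruentTo (M' M : ConvexBody Plane) : Prop :=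
  ∃ R ∈ Matrix.orthogonalGroup (Fin 2) ℝ, ∃ v : Plane,
    (M' : Set Plane) = (fun x => matAct R x + v) '' (M : Set Plane)

end

/-! ### Support functions of plane convex bodies -/

/-! Support functions turn the problem into Fourier analysis. For a rotation `R` by `φ`, the body `M
- R M` has support function `h(θ) + h(θ + π - φ)` (`supportFn_subRot`), and every plane convex body
has area `π ∑ (1 - n²)|c_n|²` (`hasSum_volume`). With `ψ = π - φ` the excluded area is therefore `2π
∑ (1 - n²)|c_n|² (1 + cos nψ)` (`hasSum_excludedArea`). This depends only on the moduli `|c_n|`, `n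
≠ ±1`, and conversely its Fourier coefficients in `ψ` recover them.

The area formula is needed for bodies without smoothness, since the competing body is arbitrary. For
a positive `C²` support function with `h + h'' > 0`, polar-type coordinates give the area as `½ ∫ h
(h + h'')`, and Parseval gives the series. In general `h` is mollified and a small constant is
added: areas converge by squeezing between `K` and its parallel bodies, and the series by
monotonicity of the weights.

A rotation multiplies `c_n` by `e^{-inφ}`, a reflection also conjugates it, and a translation
changes only `c_{±1}`. If at most one `c_n` with `n ≥ 2` is nonzero, its phase is absorbed by a
rotation, `c_1` by a translation, and `c_0 ≥ 0` is fixed by its modulus. If `c_m, c_n ≠ 0` with `2 ≤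
m < n`, replace `c_n` by `e^{iε} c_n`. For small `ε` this is still a support function, because a
`C²₊` body has `h + h'' ≥ δ > 0` (`IsC2Plus.supportFn_isPeriodicC2`, via the tangent angle). A
congruence with the original would force `e^{iεm}` to take one of two fixed values, which small `ε`
can avoid. -/

lemma inner_unitVec (θ : ℝ) (x : Plane) :
    inner ℝ (unitVec θ) x = Real.cos θ * x 0 + Real.sin θ * x 1 := by
  simp [unitVec, PiLp.inner_apply, Fin.sum_univ_two]; ring

lemma continuous_inner_unitVec :
    Continuous (fun p : ℝ × Plane => (inner ℝ (unitVec p.1) p.2 : ℝ)) := by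
  simp only [inner_unitVec]; fun_prop

lemma isLUB_supportFn (M : ConvexBody Plane) (θ : ℝ) :
    IsLUB ((fun x : Plane => (inner ℝ (unitVec θ) x : ℝ)) '' (M : Set Plane)) (supportFn M θ) := by
  refine isLUB_csSup (M.nonempty.image _) ?_
  refine (M.isCompact.image ?_).bddAbove
  simp only [inner_unitVec]; fun_prop

lemma inner_le_supportFn {M : ConvexBody Plane} {x : Plane} (hx : x ∈ (M : Set Plane)) (θ : ℝ) :
    inner ℝ (unitVec θ) x ≤ supportFn M θ :=
  (isLUB_supportFn M θ).1 (Set.mem_image_of_mem _ hx)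

lemma supportFn_le {M : ConvexBody Plane} {θ c : ℝ}
    (h : ∀ x ∈ (M : Set Plane), inner ℝ (unitVec θ) x ≤ c) : supportFn M θ ≤ c :=
  (isLUB_supportFn M θ).2 (by rintro _ ⟨x, hx, rfl⟩; exact h x hx)

lemma supportFn_eq_of_forall_le {M : ConvexBody Plane} {θ c : ℝ} {x : Plane}
    (hx : x ∈ (M : Set Plane)) (hc : inner ℝ (unitVec θ) x = c)
    (h : ∀ y ∈ (M : Set Plane), inner ℝ (unitVec θ) y ≤ c) : supportFn M θ = c :=
  le_antisymm (supportFn_le h) (hc ▸ inner_le_supportFn hx θ)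

lemma exists_inner_eq_supportFn (M : ConvexBody Plane) (θ : ℝ) :
    ∃ x ∈ (M : Set Plane), inner ℝ (unitVec θ) x = supportFn M θ := by
  have hc : ContinuousOn (fun x : Plane => (inner ℝ (unitVec θ) x : ℝ)) M := by
    simp only [inner_unitVec]; fun_prop
  obtain ⟨x, hx, h⟩ := M.isCompact.exists_sSup_image_eq M.nonempty hc
  exact ⟨x, hx, h.symm⟩

lemma continuous_supportFn (M : ConvexBody Plane) : Continuous (supportFn M) :=
  M.isCompact.continuous_sSup (f := fun θ (x : Plane) => (inner ℝ (unitVec θ) x : ℝ))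
    continuous_inner_unitVec

lemma unitVec_add_two_pi (θ : ℝ) : unitVec (θ + 2 * Real.pi) = unitVec θ := by
  simp [unitVec]

lemma periodic_supportFn (M : ConvexBody Plane) :
    Function.Periodic (supportFn M) (2 * Real.pi) := by
  intro θ; simp only [supportFn, unitVec_add_two_pi]

lemma exists_eq_smul_unitVec (w : Plane) : ∃ θ : ℝ, w = ‖w‖ • unitVec θ := by
  set z : ℂ := ⟨w 0, w 1⟩ with hz
  have hn : ‖w‖ = ‖z‖ := by
    rw [EuclideanSpace.norm_eq, Complex.norm_eq_sqrt_sq_add_sq]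
    simp [Fin.sum_univ_two, hz]
  refine ⟨z.arg, ?_⟩
  ext i
  fin_cases i
  · simp [unitVec, hn, Complex.norm_mul_cos_arg]; rfl
  · simp [unitVec, hn, Complex.norm_mul_sin_arg]; rfl

/-- A point satisfying all the support inequalities of a convex body belongs to it. -/
lemma mem_of_forall_inner_le {M : ConvexBody Plane} {x : Plane}
    (h : ∀ θ, inner ℝ (unitVec θ) x ≤ supportFn M θ) : x ∈ (M : Set Plane) := by
  by_contra hx
  obtain ⟨f, u, hf, hu⟩ := geometric_hahn_banach_closed_point M.convex M.isClosed hx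
  obtain ⟨w, rfl⟩ := (InnerProductSpace.toDual ℝ Plane).surjective f
  obtain ⟨θ, hθ⟩ := exists_eq_smul_unitVec w
  obtain ⟨y, hy, hyθ⟩ := exists_inner_eq_supportFn M θ
  have h1 := (hf y hy).trans hu
  simp only [InnerProductSpace.toDual_apply_apply] at h1
  -- The separating functional is a nonnegative multiple of some `u_θ`; separation contradicts the
  -- support inequality in that direction.
  rw [hθ, real_inner_smul_left, real_inner_smul_left, hyθ] at h1
  exact absurd h1 (not_lt.2 (mul_le_mul_of_nonneg_left (h θ) (norm_nonneg _)))

lemma subset_of_supportFn_le {M N : ConvexBody Plane} (h : ∀ θ, supportFn M θ ≤ supportFn N θ) :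
    (M : Set Plane) ⊆ N :=
  fun _ hx => mem_of_forall_inner_le fun θ => (inner_le_supportFn hx θ).trans (h θ)

lemma coe_eq_of_supportFn_eq {M N : ConvexBody Plane} (h : supportFn M = supportFn N) :
    (M : Set Plane) = N :=
  (subset_of_supportFn_le fun θ => (congrFun h θ).le).antisymm
    (subset_of_supportFn_le fun θ => (congrFun h θ).ge)

/-- Sublinearity of the support function, in terms of angles. -/
lemma two_cos_mul_supportFn_le (M : ConvexBody Plane) (θ δ : ℝ) :
    2 * Real.cos δ * supportFn M θ ≤ supportFn M (θ + δ) + supportFn M (θ - δ) := by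
  obtain ⟨x, hx, h⟩ := exists_inner_eq_supportFn M θ
  have h1 := inner_le_supportFn hx (θ + δ)
  have h2 := inner_le_supportFn hx (θ - δ)
  rw [← h]
  rw [inner_unitVec] at h1 h2 ⊢
  rw [Real.cos_add, Real.sin_add] at h1
  rw [Real.cos_sub, Real.sin_sub] at h2
  linarith

/-! ### Rotations, reflections and their effect on support functions -/

/-- The rotation by the angle `φ`. -/
noncomputable def rotMat (φ : ℝ) : Matrix (Fin 2) (Fin 2) ℝ :=
  !![Real.cos φ, -Real.sin φ; Real.sin φ, Real.cos φ]

/-- The reflection in the line of angle `φ / 2`. -/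
noncomputable def reflMat (φ : ℝ) : Matrix (Fin 2) (Fin 2) ℝ :=
  !![Real.cos φ, Real.sin φ; Real.sin φ, -Real.cos φ]

lemma matAct_apply (R : Matrix (Fin 2) (Fin 2) ℝ) (x : Plane) (i : Fin 2) :
    matAct R x i = R i 0 * x 0 + R i 1 * x 1 := by
  simp [matAct, Matrix.mulVec, dotProduct, Fin.sum_univ_two]

lemma rotMat_mem (φ : ℝ) : rotMat φ ∈ Matrix.specialOrthogonalGroup (Fin 2) ℝ := by
  rw [Matrix.mem_specialOrthogonalGroup_iff, Matrix.mem_orthogonalGroup_iff]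
  have := Real.sin_sq_add_cos_sq φ
  refine ⟨?_, ?_⟩
  · ext i j
    fin_cases i <;> fin_cases j <;>
      simp [rotMat, Matrix.mul_apply, Fin.sum_univ_two] <;> nlinarith
  · simp [rotMat, Matrix.det_fin_two_of]; nlinarith

lemma exists_eq_rotMat_or_reflMat {R : Matrix (Fin 2) (Fin 2) ℝ}
    (hR : R ∈ Matrix.orthogonalGroup (Fin 2) ℝ) :
    (∃ φ, R = rotMat φ) ∨ (R.det = -1 ∧ ∃ φ, R = reflMat φ) := by
  rw [Matrix.mem_orthogonalGroup_iff'] at hR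
  have h00 := congrFun (congrFun hR 0) 0
  have h01 := congrFun (congrFun hR 0) 1
  have h11 := congrFun (congrFun hR 1) 1
  simp only [Matrix.mul_apply, Fin.sum_univ_two, Matrix.transpose_apply,
    Matrix.one_apply_eq, Matrix.one_apply, if_false, zero_ne_one] at h00 h01 h11
  obtain ⟨φ, hφ⟩ := exists_eq_smul_unitVec (!₂[R 0 0, R 1 0] : Plane)
  have hn : ‖(!₂[R 0 0, R 1 0] : Plane)‖ = 1 := by
    rw [EuclideanSpace.norm_eq, Real.sqrt_eq_one]
    simp [Fin.sum_univ_two]; nlinarith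
  rw [hn, one_smul] at hφ
  have a0 : R 0 0 = Real.cos φ := by simpa [unitVec] using congrArg (fun v : Plane => v 0) hφ
  have a1 : R 1 0 = Real.sin φ := by simpa [unitVec] using congrArg (fun v : Plane => v 1) hφ
  have hsc := Real.sin_sq_add_cos_sq φ
  rw [a0, a1] at h01
  -- `d` is the determinant: orthogonality to the first column `(cos φ, sin φ)` makes the second
  -- column `d (-sin φ, cos φ)`, and its unit length gives `d = ±1`.
  set d := Real.cos φ * R 1 1 - Real.sin φ * R 0 1 with hd
  have b0 : R 0 1 = - Real.sin φ * d := by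
    rw [hd]; linear_combination Real.cos φ * h01 - R 0 1 * hsc
  have b1 : R 1 1 = Real.cos φ * d := by
    rw [hd]; linear_combination Real.sin φ * h01 - R 1 1 * hsc
  have hd2 : d ^ 2 = 1 := by
    rw [b0, b1] at h11; linear_combination h11 - d ^ 2 * hsc
  have hdet : R.det = d := by
    rw [Matrix.det_fin_two, a0, a1, b0, b1]; linear_combination d * hsc
  rcases eq_or_eq_neg_of_sq_eq_sq d 1 (by rw [hd2, one_pow]) with h | h
  · left; refine ⟨φ, ?_⟩
    ext i j
    fin_cases i <;> fin_cases j <;> simp [rotMat, a0, a1, b0, b1, h]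
  · right; refine ⟨hdet.trans h, φ, ?_⟩
    ext i j
    fin_cases i <;> fin_cases j <;> simp [reflMat, a0, a1, b0, b1, h]

lemma exists_eq_rotMat {R : Matrix (Fin 2) (Fin 2) ℝ}
    (hR : R ∈ Matrix.specialOrthogonalGroup (Fin 2) ℝ) : ∃ φ, R = rotMat φ := by
  rw [Matrix.mem_specialOrthogonalGroup_iff] at hR
  rcases exists_eq_rotMat_or_reflMat hR.1 with h | ⟨h, -⟩
  · exact h
  · rw [hR.2] at h; norm_num at h

lemma inner_unitVec_rotMat (φ θ : ℝ) (x : Plane) :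
    inner ℝ (unitVec θ) (matAct (rotMat φ) x) = inner ℝ (unitVec (θ - φ)) x := by
  simp only [inner_unitVec, matAct_apply, Real.cos_sub, Real.sin_sub]
  simp [rotMat]; ring

lemma inner_unitVec_reflMat (φ θ : ℝ) (x : Plane) :
    inner ℝ (unitVec θ) (matAct (reflMat φ) x) = inner ℝ (unitVec (φ - θ)) x := by
  simp only [inner_unitVec, matAct_apply, Real.cos_sub, Real.sin_sub]
  simp [reflMat]; ring

lemma unitVec_add_pi (θ : ℝ) : unitVec (θ + Real.pi) = -unitVec θ := by
  ext i; fin_cases i <;> simp [unitVec]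

/-- If `M'` is the translate by `v` of the image of `M` under a map acting on directions by `σ`,
then its support function is `h(σ θ) + ⟨u_θ, v⟩`. -/
lemma supportFn_image_add {M M' : ConvexBody Plane} {g : Plane → Plane} {σ : ℝ → ℝ} {v : Plane}
    (hg : ∀ θ x, inner ℝ (unitVec θ) (g x) = (inner ℝ (unitVec (σ θ)) x : ℝ))
    (h : (M' : Set Plane) = (fun x => g x + v) '' (M : Set Plane)) (θ : ℝ) :
    supportFn M' θ = supportFn M (σ θ) + inner ℝ (unitVec θ) v := by
  obtain ⟨x, hx, hxθ⟩ := exists_inner_eq_supportFn M (σ θ)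
  refine supportFn_eq_of_forall_le (x := g x + v) (by rw [h]; exact ⟨x, hx, rfl⟩) ?_ ?_
  · rw [inner_add_right, hg, hxθ]
  · rw [h]
    rintro _ ⟨y, hy, rfl⟩
    simp only [inner_add_right, hg]
    gcongr
    exact inner_le_supportFn hy _

/-- The convex body `R M + v`. -/
noncomputable def ConvexBody.motion (M : ConvexBody Plane) (R : Matrix (Fin 2) (Fin 2) ℝ)
    (v : Plane) : ConvexBody Plane where
  carrier := (fun x => matAct R x + v) '' (M : Set Plane)
  convex' := by
    have h := (M.convex.linear_image (Matrix.toEuclideanCLM (n := Fin 2) (𝕜 := ℝ) R).toLinearMap)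
    have h2 := h.add (convex_singleton v)
    rw [Set.add_singleton, Set.image_image] at h2
    exact h2
  isCompact' := M.isCompact.image (by unfold matAct; fun_prop)
  nonempty' := M.nonempty.image _

/-- The convex body `M - R M`. -/
noncomputable def ConvexBody.subRot (M : ConvexBody Plane) (R : Matrix (Fin 2) (Fin 2) ℝ) :
    ConvexBody Plane where
  carrier := (M : Set Plane) - matAct R '' (M : Set Plane)
  convex' := M.convex.sub
    (M.convex.linear_image (Matrix.toEuclideanCLM (n := Fin 2) (𝕜 := ℝ) R).toLinearMap)
  isCompact' := by
    rw [sub_eq_add_neg]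
    exact M.isCompact.add (M.isCompact.image (by unfold matAct; fun_prop)).neg
  nonempty' := M.nonempty.sub (M.nonempty.image _)

/-- Support functions add under Minkowski sums, and negation shifts the direction by `π`; both
maxima are attained independently. -/
lemma supportFn_subRot (M : ConvexBody Plane) (φ θ : ℝ) :
    supportFn (M.subRot (rotMat φ)) θ = supportFn M θ + supportFn M (θ + (Real.pi - φ)) := by
  have key : ∀ y, (inner ℝ (unitVec θ) (-matAct (rotMat φ) y) : ℝ)
      = inner ℝ (unitVec (θ + (Real.pi - φ))) y := by
    intro y
    rw [inner_neg_right, inner_unitVec_rotMat, show θ + (Real.pi - φ) = θ - φ + Real.pi by ring,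
      unitVec_add_pi, inner_neg_left]
  obtain ⟨x, hx, hxθ⟩ := exists_inner_eq_supportFn M θ
  obtain ⟨y, hy, hyθ⟩ := exists_inner_eq_supportFn M (θ + (Real.pi - φ))
  refine supportFn_eq_of_forall_le (x := x - matAct (rotMat φ) y)
    (Set.sub_mem_sub hx (Set.mem_image_of_mem _ hy)) ?_ ?_
  · rw [sub_eq_add_neg, inner_add_right, key, hxθ, hyθ]
  · rintro _ ⟨a, ha, _, ⟨b, hb, rfl⟩, rfl⟩
    simp only [sub_eq_add_neg, inner_add_right, key]
    exact add_le_add (inner_le_supportFn ha _) (by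
      have := inner_le_supportFn hb (θ + (Real.pi - φ)); simpa [sub_eq_add_neg] using this)

/-! ### Convex bodies with a given support function -/

/-- The point `a u_θ + b u_θ'`, where `u_θ' = (-sin θ, cos θ)`. -/
noncomputable def contactPt (a b θ : ℝ) : Plane :=
  !₂[a * Real.cos θ - b * Real.sin θ, a * Real.sin θ + b * Real.cos θ]

lemma inner_unitVec_contactPt (a b θ ψ : ℝ) :
    inner ℝ (unitVec ψ) (contactPt a b θ) = a * Real.cos (ψ - θ) + b * Real.sin (ψ - θ) := by
  rw [inner_unitVec, Real.cos_sub, Real.sin_sub]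
  simp [contactPt]; ring

/-- `f` is a `2π`-periodic function with first and second derivatives `f'` and `f''`, the latter
continuous. -/
structure IsPeriodicC2 (f f' f'' : ℝ → ℝ) : Prop where
  hasDerivAt : ∀ θ, HasDerivAt f (f' θ) θ
  hasDerivAt' : ∀ θ, HasDerivAt f' (f'' θ) θ
  cont : Continuous f''
  per : Function.Periodic f (2 * Real.pi)

namespace IsPeriodicC2

variable {f f' f'' : ℝ → ℝ}

lemma continuous (H : IsPeriodicC2 f f' f'') : Continuous f :=
  continuous_iff_continuousAt.2 fun θ => (H.hasDerivAt θ).continuousAt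

lemma continuous' (H : IsPeriodicC2 f f' f'') : Continuous f' :=
  continuous_iff_continuousAt.2 fun θ => (H.hasDerivAt' θ).continuousAt

lemma per' (H : IsPeriodicC2 f f' f'') : Function.Periodic f' (2 * Real.pi) := fun θ => by
  have h := (H.hasDerivAt (θ + 2 * Real.pi)).comp_add_const θ (2 * Real.pi)
  simp only [H.per _] at h
  exact h.unique (H.hasDerivAt θ)

lemma comp_neg (H : IsPeriodicC2 f f' f'') :
    IsPeriodicC2 (fun t => f (-t)) (fun t => -f' (-t)) (fun t => f'' (-t)) where
  hasDerivAt θ := by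
    convert! (H.hasDerivAt (-θ)).scomp θ (hasDerivAt_neg θ) using 1; simp
  hasDerivAt' θ := by
    convert! ((H.hasDerivAt' (-θ)).scomp θ (hasDerivAt_neg θ)).neg using 1; simp
  cont := H.cont.comp continuous_neg
  per θ := by
    simpa only [neg_add, ← sub_eq_add_neg] using H.per.sub_eq (-θ)

lemma add {g g' g'' : ℝ → ℝ} (H : IsPeriodicC2 f f' f'') (G : IsPeriodicC2 g g' g'') :
    IsPeriodicC2 (fun t => f t + g t) (fun t => f' t + g' t) (fun t => f'' t + g'' t) where
  hasDerivAt θ := (H.hasDerivAt θ).add (G.hasDerivAt θ)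
  hasDerivAt' θ := (H.hasDerivAt' θ).add (G.hasDerivAt' θ)
  cont := H.cont.add G.cont
  per := H.per.add G.per

/-- The function is the component along `u_ψ` of the contact point at angle `t`, equal to `f ψ` at
`t = ψ`. The contact point moves along the tangent with speed `f + f''`, so the sign of `f + f''`
makes this component monotone up to `ψ`. -/
lemma hasDerivAt_aux (H : IsPeriodicC2 f f' f'') (ψ t : ℝ) :
    HasDerivAt (fun t => f t * Real.cos (ψ - t) + f' t * Real.sin (ψ - t))
      ((f t + f'' t) * Real.sin (ψ - t)) t := by
  have hs : HasDerivAt (fun t => ψ - t) (-1) t := by simpa using (hasDerivAt_id t).const_sub ψ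
  convert! ((H.hasDerivAt t).mul hs.cos).add ((H.hasDerivAt' t).mul hs.sin) using 1
  ring

lemma le_of_mem_Icc (H : IsPeriodicC2 f f' f'') (hpos : ∀ θ, 0 ≤ f θ + f'' θ) {θ ψ : ℝ}
    (h1 : θ ≤ ψ) (h2 : ψ ≤ θ + Real.pi) :
    f θ * Real.cos (ψ - θ) + f' θ * Real.sin (ψ - θ) ≤ f ψ := by
  have hm : MonotoneOn (fun t => f t * Real.cos (ψ - t) + f' t * Real.sin (ψ - t))
      (Set.Icc θ ψ) := by
    refine monotoneOn_of_deriv_nonneg (convex_Icc _ _)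
      (fun t _ => (H.hasDerivAt_aux ψ t).continuousAt.continuousWithinAt)
      (fun t _ => (H.hasDerivAt_aux ψ t).differentiableAt.differentiableWithinAt) ?_
    intro t ht
    rw [interior_Icc] at ht
    rw [(H.hasDerivAt_aux ψ t).deriv]
    exact mul_nonneg (hpos t)
      (Real.sin_nonneg_of_nonneg_of_le_pi (by linarith [ht.2]) (by linarith [ht.1]))
  simpa using hm (Set.left_mem_Icc.2 h1) (Set.right_mem_Icc.2 h1) h1

lemma lt_of_mem_Ioc (H : IsPeriodicC2 f f' f'') (hpos : ∀ θ, 0 < f θ + f'' θ) {θ ψ : ℝ}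
    (h1 : θ < ψ) (h2 : ψ ≤ θ + Real.pi) :
    f θ * Real.cos (ψ - θ) + f' θ * Real.sin (ψ - θ) < f ψ := by
  have hm : StrictMonoOn (fun t => f t * Real.cos (ψ - t) + f' t * Real.sin (ψ - t))
      (Set.Icc θ ψ) := by
    refine strictMonoOn_of_deriv_pos (convex_Icc _ _)
      (fun t _ => (H.hasDerivAt_aux ψ t).continuousAt.continuousWithinAt) ?_
    intro t ht
    rw [interior_Icc] at ht
    rw [(H.hasDerivAt_aux ψ t).deriv]
    exact mul_pos (hpos t)
      (Real.sin_pos_of_pos_of_lt_pi (by linarith [ht.2]) (by linarith [ht.1]))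
  simpa using hm (Set.left_mem_Icc.2 h1.le) (Set.right_mem_Icc.2 h1.le) h1

/-- Every angle agrees modulo `2π` with one at distance at most `π` from `θ`. -/
lemma exists_angle_near (θ ψ : ℝ) : ∃ (k : ℤ) (ψ₀ : ℝ), ψ = ψ₀ + k * (2 * Real.pi) ∧
    θ - Real.pi ≤ ψ₀ ∧ ψ₀ ≤ θ + Real.pi := by
  refine ⟨toIocDiv Real.two_pi_pos (θ - Real.pi) ψ, toIocMod Real.two_pi_pos (θ - Real.pi) ψ,
    ?_, ?_, ?_⟩
  · rw [← zsmul_eq_mul, toIocMod_add_toIocDiv_zsmul]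
  · exact (toIocMod_mem_Ioc Real.two_pi_pos (θ - Real.pi) ψ).1.le
  · have := (toIocMod_mem_Ioc Real.two_pi_pos (θ - Real.pi) ψ).2
    linarith

/-- By periodicity `ψ` may be taken within `π` of `θ`. Ahead of `θ` the monotonicity argument
applies directly; behind it, apply the same argument to `t ↦ f (-t)`. -/
lemma inner_contactPt_le (H : IsPeriodicC2 f f' f'') (hpos : ∀ θ, 0 ≤ f θ + f'' θ) (θ ψ : ℝ) :
    inner ℝ (unitVec ψ) (contactPt (f θ) (f' θ) θ) ≤ f ψ := by
  rw [inner_unitVec_contactPt]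
  obtain ⟨k, ψ, rfl, h1, h2⟩ := exists_angle_near θ ψ
  rw [add_sub_right_comm, Real.cos_add_int_mul_two_pi, Real.sin_add_int_mul_two_pi,
    H.per.int_mul k ψ]
  rcases le_total θ ψ with h | h
  · exact H.le_of_mem_Icc hpos h h2
  · have := H.comp_neg.le_of_mem_Icc (fun t => hpos (-t)) (θ := -θ) (ψ := -ψ)
      (by linarith) (by linarith)
    rw [show -ψ - -θ = -(ψ - θ) by ring, Real.cos_neg, Real.sin_neg] at this
    simpa using this

lemma inner_contactPt_lt (H : IsPeriodicC2 f f' f'') (hpos : ∀ θ, 0 < f θ + f'' θ) {θ ψ : ℝ}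
    (hne : Real.cos (ψ - θ) ≠ 1) :
    inner ℝ (unitVec ψ) (contactPt (f θ) (f' θ) θ) < f ψ := by
  rw [inner_unitVec_contactPt]
  obtain ⟨k, ψ, rfl, h1, h2⟩ := exists_angle_near θ ψ
  rw [add_sub_right_comm, Real.cos_add_int_mul_two_pi] at hne
  rw [add_sub_right_comm, Real.cos_add_int_mul_two_pi, Real.sin_add_int_mul_two_pi,
    H.per.int_mul k ψ]
  rcases lt_trichotomy θ ψ with h | h | h
  · exact H.lt_of_mem_Ioc hpos h h2
  · simp [h] at hne
  · have := H.comp_neg.lt_of_mem_Ioc (fun t => hpos (-t)) (θ := -θ) (ψ := -ψ)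
      (by linarith) (by linarith)
    rw [show -ψ - -θ = -(ψ - θ) by ring, Real.cos_neg, Real.sin_neg] at this
    simpa using this

/-- A `C²` function with `f + f'' ≥ 0` is the support function of a convex body. -/
lemma exists_supportFn_eq (H : IsPeriodicC2 f f' f'') (hpos : ∀ θ, 0 ≤ f θ + f'' θ) :
    ∃ K : ConvexBody Plane, supportFn K = f := by
  -- The intersection of the half-planes prescribed by `f`; the contact points show that each
  -- constraint is attained.
  set s : Set Plane := {x | ∀ θ, inner ℝ (unitVec θ) x ≤ f θ} with hs
  have hc : ∀ θ, contactPt (f θ) (f' θ) θ ∈ s := fun θ ψ => H.inner_contactPt_le hpos θ ψ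
  have hconv : Convex ℝ s := by
    intro x hx y hy a b ha hb hab θ
    rw [inner_add_right, inner_smul_right, inner_smul_right]
    have h1 := mul_le_mul_of_nonneg_left (hx θ) ha
    have h2 := mul_le_mul_of_nonneg_left (hy θ) hb
    have : f θ = a * f θ + b * f θ := by rw [← add_mul, hab, one_mul]
    linarith
  have hclosed : IsClosed s := by
    have : s = ⋂ θ, {x : Plane | inner ℝ (unitVec θ) x ≤ f θ} := by ext x; simp [hs]
    rw [this]
    exact isClosed_iInter fun θ => isClosed_le (by fun_prop) continuous_const
  have hbdd : Bornology.IsBounded s := by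
    have hb := H.per.isBounded_of_continuous Real.two_pi_pos.ne' H.continuous
    obtain ⟨C, hC⟩ := hb.bddAbove
    refine (Metric.isBounded_closedBall (x := (0 : Plane)) (r := C)).subset fun x hx => ?_
    obtain ⟨θ, hθ⟩ := exists_eq_smul_unitVec x
    have h1 := hx θ
    have h2 : (inner ℝ (unitVec θ) (unitVec θ) : ℝ) = 1 := by
      rw [inner_unitVec]; simp [unitVec]; nlinarith [Real.sin_sq_add_cos_sq θ]
    rw [hθ, inner_smul_right, h2, mul_one] at h1
    simpa using h1.trans (hC ⟨θ, rfl⟩)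
  refine ⟨⟨s, hconv, Metric.isCompact_of_isClosed_isBounded hclosed hbdd, ⟨_, hc 0⟩⟩, ?_⟩
  funext θ
  refine supportFn_eq_of_forall_le (x := contactPt (f θ) (f' θ) θ) (hc θ) ?_ fun y hy => hy θ
  rw [inner_unitVec_contactPt]; simp

end IsPeriodicC2

/-! ### The area of a smooth convex body -/

/-- The coordinates of the plane, as a measurable equivalence. -/
noncomputable def planeEquiv : Plane ≃ᵐ ℝ × ℝ :=
  (MeasurableEquiv.toLp 2 (Fin 2 → ℝ)).symm.trans MeasurableEquiv.finTwoArrow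

lemma planeEquiv_apply (x : Plane) : planeEquiv x = (x 0, x 1) := rfl

lemma measurePreserving_planeEquiv : MeasureTheory.MeasurePreserving planeEquiv :=
  (MeasureTheory.volume_preserving_finTwoArrow ℝ).comp
    (EuclideanSpace.volume_preserving_symm_measurableEquiv_toLp (Fin 2))

lemma volume_real_image_planeEquiv (s : Set Plane) :
    MeasureTheory.volume.real (planeEquiv '' s) = MeasureTheory.volume.real s := by
  rw [MeasurableEquiv.image_eq_preimage_symm, MeasureTheory.measureReal_def,
    MeasureTheory.measureReal_def,
    (measurePreserving_planeEquiv.symm planeEquiv).measure_preimage_equiv]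

namespace IsPeriodicC2

variable {f f' f'' : ℝ → ℝ}

/-- The map `(s, θ) ↦ s (f u_θ + f' u_θ')` in coordinates. -/
noncomputable def _root_.coneMap (f f' : ℝ → ℝ) (p : ℝ × ℝ) : ℝ × ℝ :=
  (p.1 * (f p.2 * Real.cos p.2 - f' p.2 * Real.sin p.2),
    p.1 * (f p.2 * Real.sin p.2 + f' p.2 * Real.cos p.2))

lemma _root_.planeEquiv_smul_contactPt (f f' : ℝ → ℝ) (s θ : ℝ) :
    planeEquiv (s • contactPt (f θ) (f' θ) θ) = coneMap f f' (s, θ) := by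
  simp [planeEquiv_apply, contactPt, coneMap]

/-- The derivative of `coneMap`. -/
noncomputable def _root_.coneMapDeriv (f f' f'' : ℝ → ℝ) (p : ℝ × ℝ) : ℝ × ℝ →L[ℝ] ℝ × ℝ :=
  (Matrix.toLin (.finTwoProd ℝ) (.finTwoProd ℝ)
    !![f p.2 * Real.cos p.2 - f' p.2 * Real.sin p.2, -(p.1 * ((f p.2 + f'' p.2) * Real.sin p.2));
      f p.2 * Real.sin p.2 + f' p.2 * Real.cos p.2,
        p.1 * ((f p.2 + f'' p.2) * Real.cos p.2)]).toContinuousLinearMap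

lemma det_coneMapDeriv (p : ℝ × ℝ) :
    (coneMapDeriv f f' f'' p).det = p.1 * (f p.2 * (f p.2 + f'' p.2)) := by
  unfold coneMapDeriv
  simp only [LinearMap.det_toContinuousLinearMap, LinearMap.det_toLin, Matrix.det_fin_two_of]
  linear_combination (p.1 * (f p.2 * (f p.2 + f'' p.2))) * Real.sin_sq_add_cos_sq p.2

lemma hasFDerivAt_coneMap (H : IsPeriodicC2 f f' f'') (p : ℝ × ℝ) :
    HasFDerivAt (coneMap f f') (coneMapDeriv f f' f'' p) p := by
  have hX : HasDerivAt (fun θ => f θ * Real.cos θ - f' θ * Real.sin θ)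
      (-((f p.2 + f'' p.2) * Real.sin p.2)) p.2 := by
    convert! ((H.hasDerivAt p.2).mul (Real.hasDerivAt_cos p.2)).sub
      ((H.hasDerivAt' p.2).mul (Real.hasDerivAt_sin p.2)) using 1
    ring
  have hY : HasDerivAt (fun θ => f θ * Real.sin θ + f' θ * Real.cos θ)
      ((f p.2 + f'' p.2) * Real.cos p.2) p.2 := by
    convert! ((H.hasDerivAt p.2).mul (Real.hasDerivAt_sin p.2)).add
      ((H.hasDerivAt' p.2).mul (Real.hasDerivAt_cos p.2)) using 1
    ring
  unfold coneMapDeriv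
  rw [Matrix.toLin_finTwoProd_toContinuousLinearMap]
  convert!
    HasFDerivAt.prodMk (𝕜 := ℝ)
      (hasFDerivAt_fst.mul (hX.comp_hasFDerivAt p hasFDerivAt_snd))
      (hasFDerivAt_fst.mul (hY.comp_hasFDerivAt p hasFDerivAt_snd)) using
    2 <;>
  simp [smul_smul, add_comm, neg_smul _ (ContinuousLinearMap.snd ℝ ℝ ℝ)]

/-- Each ray from the origin meets the boundary once. If two scaled contact points agree, pairing
with the normal of the one with the larger scale forces equal scales, and strictness of the support
inequality forces equal angles. -/
lemma injOn_coneMap (H : IsPeriodicC2 f f' f'') (h0 : ∀ θ, 0 < f θ)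
    (hpos : ∀ θ, 0 < f θ + f'' θ) :
    Set.InjOn (coneMap f f') (Set.Ioc 0 1 ×ˢ Set.Ioc (-Real.pi) Real.pi) := by
  have key : ∀ s t θ ψ : ℝ, 0 < s → s ≤ t →
      s • contactPt (f θ) (f' θ) θ = t • contactPt (f ψ) (f' ψ) ψ →
      s = t ∧ Real.cos (ψ - θ) = 1 := by
    intro s t θ ψ hs hst h
    have h1 := congrArg (fun x => (inner ℝ (unitVec ψ) x : ℝ)) h
    simp only [inner_smul_right] at h1
    rw [inner_unitVec_contactPt (f ψ)] at h1
    simp only [sub_self, Real.cos_zero, Real.sin_zero, mul_one, mul_zero, add_zero] at h1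
    have hle := H.inner_contactPt_le (fun θ => (hpos θ).le) θ ψ
    have hts : t = s := by
      refine le_antisymm (le_of_mul_le_mul_right ?_ (h0 ψ)) hst
      rw [← h1]
      exact mul_le_mul_of_nonneg_left hle hs.le
    refine ⟨hts.symm, ?_⟩
    by_contra hne
    have hlt := H.inner_contactPt_lt hpos hne
    rw [hts] at h1
    exact hlt.ne (mul_left_cancel₀ hs.ne' h1)
  rintro ⟨s, θ⟩ ⟨hs, hθ⟩ ⟨t, ψ⟩ ⟨ht, hψ⟩ h
  rw [← planeEquiv_smul_contactPt, ← planeEquiv_smul_contactPt] at h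
  have h := planeEquiv.injective h
  have hmain : s = t ∧ Real.cos (ψ - θ) = 1 := by
    rcases le_total s t with hst | hst
    · exact key s t θ ψ hs.1 hst h
    · obtain ⟨h1, h2⟩ := key t s ψ θ ht.1 hst h.symm
      exact ⟨h1.symm, by rwa [← Real.cos_neg, neg_sub]⟩
  obtain ⟨rfl, hc⟩ := hmain
  have hθ1 := hθ.1
  have hθ2 := hθ.2
  have hψ1 := hψ.1
  have hψ2 := hψ.2
  simp only at hθ1 hθ2 hψ1 hψ2
  rw [Real.cos_eq_one_iff_of_lt_of_lt (by linarith) (by linarith)] at hc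
  rw [sub_eq_zero.1 hc]

/-- For surjectivity, maximise `q θ = ⟨u_θ, y⟩ / f θ`, whose maximum is the gauge of `y`. The
critical point equation at a maximiser says that the tangential component of `y` is `q f'`, so `y`
is `q` times the contact point there. -/
lemma image_coneMap (H : IsPeriodicC2 f f' f'') (h0 : ∀ θ, 0 < f θ)
    (hpos : ∀ θ, 0 < f θ + f'' θ) {K : ConvexBody Plane} (hK : supportFn K = f) :
    coneMap f f' '' (Set.Ioc 0 1 ×ˢ Set.Ioc (-Real.pi) Real.pi)
      = planeEquiv '' ((K : Set Plane) \ {0}) := by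
  have hmem : ∀ θ, contactPt (f θ) (f' θ) θ ∈ (K : Set Plane) := fun θ =>
    mem_of_forall_inner_le fun ψ => by
      rw [hK]; exact H.inner_contactPt_le (fun θ => (hpos θ).le) θ ψ
  have hzero : (0 : Plane) ∈ (K : Set Plane) :=
    mem_of_forall_inner_le fun ψ => by rw [hK, inner_zero_right]; exact (h0 ψ).le
  apply Set.Subset.antisymm
  · rintro _ ⟨⟨s, θ⟩, ⟨hs, -⟩, rfl⟩
    refine ⟨s • contactPt (f θ) (f' θ) θ, ⟨?_, ?_⟩, planeEquiv_smul_contactPt f f' s θ⟩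
    · exact K.convex.smul_mem_of_zero_mem hzero (hmem θ) ⟨hs.1.le, hs.2⟩
    · intro h
      have h1 := congrArg (fun x => (inner ℝ (unitVec θ) x : ℝ)) (Set.mem_singleton_iff.1 h)
      simp only [inner_smul_right, inner_unitVec_contactPt, inner_zero_right] at h1
      simp at h1
      exact h1.elim hs.1.ne' (h0 θ).ne'
  · rintro _ ⟨y, ⟨hy, hy0⟩, rfl⟩
    set q : ℝ → ℝ := fun θ => inner ℝ (unitVec θ) y / f θ with hq
    have hqd : ∀ θ, HasDerivAt q (((-Real.sin θ * y 0 + Real.cos θ * y 1) * f θ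
        - (Real.cos θ * y 0 + Real.sin θ * y 1) * f' θ) / f θ ^ 2) θ := by
      intro θ
      simp only [hq, inner_unitVec]
      exact (((Real.hasDerivAt_cos θ).mul_const _).add
        ((Real.hasDerivAt_sin θ).mul_const _)).div (H.hasDerivAt θ) (h0 θ).ne'
    have hqc : Continuous q := continuous_iff_continuousAt.2 fun θ => (hqd θ).continuousAt
    have hqp : Function.Periodic q (2 * Real.pi) := fun θ => by
      simp only [hq, unitVec_add_two_pi, H.per θ]
    obtain ⟨θ₁, hθ₁⟩ : ∃ θ, ∀ ψ, q ψ ≤ q θ := by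
      obtain ⟨θ, -, hθ⟩ := isCompact_Icc.exists_isMaxOn
        (Set.nonempty_Icc.2 Real.two_pi_pos.le) hqc.continuousOn
      refine ⟨θ, fun ψ => ?_⟩
      obtain ⟨ψ', h1, h2⟩ := hqp.exists_mem_Ico₀ Real.two_pi_pos ψ
      rw [h2]; exact hθ (Set.Ico_subset_Icc_self h1)
    obtain ⟨θ, hθ, hθq⟩ := hqp.exists_mem_Ioc Real.two_pi_pos θ₁ (-Real.pi)
    rw [hθq] at hθ₁
    have hd := (hqd θ).deriv
    rw [IsLocalMax.deriv_eq_zero (Filter.Eventually.of_forall hθ₁)] at hd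
    rw [eq_comm, div_eq_zero_iff] at hd
    have hd := hd.resolve_right (pow_ne_zero 2 (h0 θ).ne')
    have hqpos : 0 < q θ := by
      obtain ⟨ψ, hψ⟩ := exists_eq_smul_unitVec y
      refine lt_of_lt_of_le (div_pos ?_ (h0 ψ)) (hθ₁ ψ)
      have h2 : (inner ℝ (unitVec ψ) (unitVec ψ) : ℝ) = 1 := by
        rw [inner_unitVec]; simp [unitVec]; nlinarith [Real.sin_sq_add_cos_sq ψ]
      rw [hψ, inner_smul_right, h2, mul_one]
      exact norm_pos_iff.2 hy0
    refine ⟨(q θ, θ), ⟨⟨hqpos, ?_⟩, ?_⟩, ?_⟩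
    · rw [hq, div_le_one (h0 θ), ← hK]
      exact inner_le_supportFn hy θ
    · rwa [show -Real.pi + 2 * Real.pi = Real.pi by ring] at hθ
    · have hf := (h0 θ).ne'
      have hqf : q θ * f θ = Real.cos θ * y 0 + Real.sin θ * y 1 := by
        simp only [hq, inner_unitVec]; field_simp
      have hqf' : q θ * f' θ = -Real.sin θ * y 0 + Real.cos θ * y 1 := by
        refine mul_right_cancel₀ hf ?_
        rw [mul_right_comm, hqf]; linarith
      have hsc := Real.sin_sq_add_cos_sq θ
      rw [planeEquiv_apply]
      refine Prod.ext ?_ ?_ <;> simp only [coneMap]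
      · linear_combination Real.cos θ * hqf - Real.sin θ * hqf' + y 0 * hsc
      · linear_combination Real.sin θ * hqf + Real.cos θ * hqf' + y 1 * hsc

/-- The area of a convex body containing the origin in its interior, whose support function `f`
is `C²` with `f + f'' > 0`. -/
lemma volume_real_eq (H : IsPeriodicC2 f f' f'') (h0 : ∀ θ, 0 < f θ)
    (hpos : ∀ θ, 0 < f θ + f'' θ) {K : ConvexBody Plane} (hK : supportFn K = f) :
    MeasureTheory.volume.real (K : Set Plane)
      = 1 / 2 * ∫ θ in (-Real.pi)..Real.pi, f θ * (f θ + f'' θ) := by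
  have h1 : MeasureTheory.volume.real (K : Set Plane)
      = MeasureTheory.volume.real ((K : Set Plane) \ {0}) := by
    rw [MeasureTheory.measureReal_def, MeasureTheory.measureReal_def,
      MeasureTheory.measure_sdiff_null (MeasureTheory.measure_singleton _)]
  have hS : MeasurableSet (Set.Ioc (0 : ℝ) 1 ×ˢ Set.Ioc (-Real.pi) Real.pi) :=
    measurableSet_Ioc.prod measurableSet_Ioc
  -- Change of variables: the Jacobian is `s f (f + f'')`, and the integral over `s` supplies the
  -- factor `1 / 2`.
  have h2 := MeasureTheory.integral_image_eq_integral_abs_det_fderiv_smul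
    (MeasureTheory.volume : MeasureTheory.Measure (ℝ × ℝ)) hS
    (fun p _ => (H.hasFDerivAt_coneMap p).hasFDerivWithinAt) (H.injOn_coneMap h0 hpos)
    (fun _ => (1 : ℝ))
  rw [H.image_coneMap h0 hpos hK, MeasureTheory.setIntegral_const, smul_eq_mul, mul_one,
    volume_real_image_planeEquiv, ← h1] at h2
  rw [h2]
  have h3 : ∀ p ∈ Set.Ioc (0 : ℝ) 1 ×ˢ Set.Ioc (-Real.pi) Real.pi,
      |(coneMapDeriv f f' f'' p).det| • (1 : ℝ) = p.1 * (f p.2 * (f p.2 + f'' p.2)) := by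
    intro p hp
    rw [det_coneMapDeriv, smul_eq_mul, mul_one,
      abs_of_pos (mul_pos hp.1.1 (mul_pos (h0 _) (hpos _)))]
  rw [MeasureTheory.setIntegral_congr_fun hS h3, MeasureTheory.Measure.volume_eq_prod,
    MeasureTheory.setIntegral_prod_mul (fun s : ℝ => s) (fun θ => f θ * (f θ + f'' θ)),
    ← intervalIntegral.integral_of_le zero_le_one,
    ← intervalIntegral.integral_of_le (by linarith [Real.pi_pos]), integral_id]
  norm_num

end IsPeriodicC2

/-! ### Fourier coefficients of real periodic functions -/

/-- The Fourier coefficients over `[-π, π]` of a real function. -/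
noncomputable def fc (g : ℝ → ℝ) (n : ℤ) : ℂ :=
  fourierCoeffOn (neg_lt_self Real.pi_pos) (fun θ : ℝ => (g θ : ℂ)) n

lemma fc_eq_integral (g : ℝ → ℝ) (n : ℤ) :
    fc g n = (1 / (2 * Real.pi) : ℝ) *
      ∫ θ in (-Real.pi)..Real.pi, Complex.exp (-(n * θ * Complex.I)) * g θ := by
  rw [fc, fourierCoeffOn_eq_integral, show Real.pi - -Real.pi = 2 * Real.pi by ring,
    Complex.real_smul]
  congr 1
  refine intervalIntegral.integral_congr fun θ _ => ?_
  simp only [fourier_coe_apply, smul_eq_mul]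
  congr 2
  have : (Real.pi : ℂ) ≠ 0 := by exact_mod_cast Real.pi_ne_zero
  push_cast
  field_simp

lemma fc_add {f g : ℝ → ℝ} (hf : Continuous f) (hg : Continuous g) (n : ℤ) :
    fc (fun θ => f θ + g θ) n = fc f n + fc g n := by
  simp only [fc_eq_integral]
  rw [← mul_add, ← intervalIntegral.integral_add]
  · congr 1
    refine intervalIntegral.integral_congr fun θ _ => ?_
    push_cast; ring
  all_goals exact Continuous.intervalIntegrable (by fun_prop) _ _

lemma fc_const_mul (c : ℝ) (f : ℝ → ℝ) (n : ℤ) : fc (fun θ => c * f θ) n = c * fc f n := by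
  have h : ∫ θ in (-Real.pi)..Real.pi, Complex.exp (-(n * θ * Complex.I)) * ((c * f θ : ℝ) : ℂ)
      = c * ∫ θ in (-Real.pi)..Real.pi, Complex.exp (-(n * θ * Complex.I)) * f θ := by
    rw [← intervalIntegral.integral_const_mul (c : ℂ)]
    refine intervalIntegral.integral_congr fun θ _ => ?_
    push_cast; ring
  simp only [fc_eq_integral]
  rw [h, mul_left_comm]

lemma fc_sub {f g : ℝ → ℝ} (hf : Continuous f) (hg : Continuous g) (n : ℤ) :
    fc (fun θ => f θ - g θ) n = fc f n - fc g n := by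
  have h := fc_add hf (g := fun θ => (-1) * g θ) (by fun_prop) n
  rw [fc_const_mul] at h
  simpa [sub_eq_add_neg] using h

lemma fc_neg (g : ℝ → ℝ) (n : ℤ) : fc g (-n) = (starRingEnd ℂ) (fc g n) := by
  simp only [fc_eq_integral]
  rw [map_mul, Complex.conj_ofReal, intervalIntegral.intervalIntegral_eq_integral_uIoc,
    intervalIntegral.intervalIntegral_eq_integral_uIoc]
  simp only [if_pos (neg_lt_self Real.pi_pos).le, one_smul]
  rw [← integral_conj]
  congr 2
  ext θ
  simp [← Complex.exp_conj]

lemma norm_fc_neg (g : ℝ → ℝ) (n : ℤ) : ‖fc g (-n)‖ = ‖fc g n‖ := by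
  rw [fc_neg, Complex.norm_conj]

lemma fc_zero (g : ℝ → ℝ) :
    fc g 0 = ((1 / (2 * Real.pi) * ∫ θ in (-Real.pi)..Real.pi, g θ : ℝ) : ℂ) := by
  rw [fc_eq_integral]
  push_cast
  rw [← intervalIntegral.integral_ofReal]
  simp

lemma periodic_cexp_int_mul (n : ℤ) :
    Function.Periodic (fun θ : ℝ => Complex.exp (n * θ * Complex.I)) (2 * Real.pi) := by
  intro θ
  simp only
  rw [Complex.exp_eq_exp_iff_exists_int]
  exact ⟨n, by push_cast; ring⟩

lemma fc_shift {g : ℝ → ℝ} (hp : Function.Periodic g (2 * Real.pi)) (t : ℝ) (n : ℤ) :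
    fc (fun θ => g (θ + t)) n = Complex.exp (n * t * Complex.I) * fc g n := by
  simp only [fc_eq_integral]
  rw [mul_left_comm, ← intervalIntegral.integral_const_mul (Complex.exp (n * t * Complex.I))]
  congr 1
  have hp2 : Function.Periodic
      (fun θ : ℝ => Complex.exp (n * t * Complex.I) *
        (Complex.exp (-(n * θ * Complex.I)) * (g θ : ℂ))) (2 * Real.pi) := by
    intro θ
    have h := periodic_cexp_int_mul (-n) θ
    simp only [Int.cast_neg, neg_mul] at h
    simp only [hp θ, h]
  have h1 := hp2.intervalIntegral_add_eq (-Real.pi) (-Real.pi + t)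
  rw [show -Real.pi + 2 * Real.pi = Real.pi by ring,
    show -Real.pi + t + 2 * Real.pi = Real.pi + t by ring,
    ← intervalIntegral.integral_comp_add_right] at h1
  rw [h1]
  refine intervalIntegral.integral_congr fun θ _ => ?_
  rw [← mul_assoc, ← Complex.exp_add]
  congr 2
  push_cast; ring

lemma fc_comp_neg (g : ℝ → ℝ) (n : ℤ) : fc (fun θ => g (-θ)) n = fc g (-n) := by
  simp only [fc_eq_integral]
  congr 1
  have := intervalIntegral.integral_comp_neg (a := -Real.pi) (b := Real.pi)
    (fun θ : ℝ => Complex.exp (-(((-n : ℤ) : ℂ) * θ * Complex.I)) * (g θ : ℂ))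
  rw [neg_neg] at this
  rw [← this]
  refine intervalIntegral.integral_congr fun θ _ => ?_
  simp

/-- The real trigonometric monomial `b e^{inθ} + b̄ e^{-inθ}`. -/
noncomputable def trigTerm (b : ℂ) (n : ℤ) (θ : ℝ) : ℝ :=
  2 * (b * Complex.exp (n * θ * Complex.I)).re

lemma ofReal_trigTerm (b : ℂ) (n : ℤ) (θ : ℝ) :
    (trigTerm b n θ : ℂ) = b * Complex.exp (n * θ * Complex.I)
      + (starRingEnd ℂ) b * Complex.exp (-(n * θ * Complex.I)) := by
  have h : (starRingEnd ℂ) b * Complex.exp (-(n * θ * Complex.I))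
      = (starRingEnd ℂ) (b * Complex.exp (n * θ * Complex.I)) := by
    simp [← Complex.exp_conj]
  rw [h, Complex.add_conj, trigTerm]

lemma continuous_trigTerm (b : ℂ) (n : ℤ) : Continuous (trigTerm b n) := by
  unfold trigTerm; fun_prop

lemma integral_cexp_int_mul (n : ℤ) :
    ∫ θ in (-Real.pi)..Real.pi, Complex.exp (n * θ * Complex.I)
      = if n = 0 then 2 * (Real.pi : ℂ) else 0 := by
  split_ifs with h
  · simp [h]; ring
  · have hc : (n * Complex.I : ℂ) ≠ 0 := by simp [h]
    have : ∀ θ : ℝ, Complex.exp (n * θ * Complex.I) = Complex.exp (n * Complex.I * θ) := by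
      intro θ; ring_nf
    simp only [this]
    rw [integral_exp_mul_complex hc, div_eq_zero_iff]
    left
    rw [sub_eq_zero, Complex.exp_eq_exp_iff_exists_int]
    exact ⟨n, by push_cast; ring⟩

lemma fc_trigTerm (b : ℂ) (n j : ℤ) :
    fc (trigTerm b n) j = (if j = n then b else 0)
      + (if j = -n then (starRingEnd ℂ) b else 0) := by
  have h : ∀ θ : ℝ, Complex.exp (-(j * θ * Complex.I)) * (trigTerm b n θ : ℂ)
      = b * Complex.exp (((n - j : ℤ) : ℂ) * θ * Complex.I)
        + (starRingEnd ℂ) b * Complex.exp (((-n - j : ℤ) : ℂ) * θ * Complex.I) := by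
    intro θ
    rw [ofReal_trigTerm, mul_add, mul_left_comm, mul_left_comm _ ((starRingEnd ℂ) b),
      ← Complex.exp_add, ← Complex.exp_add]
    push_cast
    congr 3 <;> ring
  have hpi : (Real.pi : ℂ) ≠ 0 := by exact_mod_cast Real.pi_ne_zero
  rw [fc_eq_integral]
  simp only [h]
  rw [intervalIntegral.integral_add (Continuous.intervalIntegrable (by fun_prop) _ _)
    (Continuous.intervalIntegrable (by fun_prop) _ _), intervalIntegral.integral_const_mul,
    intervalIntegral.integral_const_mul, integral_cexp_int_mul, integral_cexp_int_mul]
  simp only [sub_eq_zero, eq_comm (b := j)]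
  push_cast
  split_ifs <;> field_simp <;> simp

lemma memLp_two_of_continuous {g : ℝ → ℝ} (hg : Continuous g) (a b : ℝ) :
    MeasureTheory.MemLp (fun θ => (g θ : ℂ)) 2
      (MeasureTheory.volume.restrict (Set.Ioc a b)) := by
  have hc : Continuous (fun θ => (g θ : ℂ)) := by fun_prop
  obtain ⟨C, hC⟩ := (isCompact_Icc (a := a) (b := b)).exists_bound_of_continuousOn
    hc.continuousOn
  refine MeasureTheory.MemLp.of_bound hc.aestronglyMeasurable C ?_
  refine (MeasureTheory.ae_restrict_iff' measurableSet_Ioc).2 (Filter.Eventually.of_forall ?_)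
  exact fun θ hθ => hC θ (Set.Ioc_subset_Icc_self hθ)

lemma hasSum_sq_fc {g : ℝ → ℝ} (hg : Continuous g) :
    HasSum (fun n => ‖fc g n‖ ^ 2)
      (1 / (2 * Real.pi) * ∫ θ in (-Real.pi)..Real.pi, g θ ^ 2) := by
  have h := hasSum_sq_fourierCoeffOn (neg_lt_self Real.pi_pos)
    (memLp_two_of_continuous hg (-Real.pi) Real.pi)
  convert! h using 1
  rw [smul_eq_mul, show Real.pi - -Real.pi = 2 * Real.pi by ring, one_div]
  simp

/-- A continuous periodic function is determined by its Fourier coefficients. -/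
lemma eq_of_fc_eq {f g : ℝ → ℝ} (hf : Continuous f) (hg : Continuous g)
    (hfp : Function.Periodic f (2 * Real.pi)) (hgp : Function.Periodic g (2 * Real.pi))
    (h : ∀ n, fc f n = fc g n) : f = g := by
  have hs := hasSum_sq_fc (hf.sub hg)
  have h0 : ∀ n, ‖fc (f - g) n‖ ^ 2 = 0 := fun n => by
    have := fc_sub hf hg n
    rw [h, sub_self] at this
    change ‖fc (fun θ => f θ - g θ) n‖ ^ 2 = 0
    rw [this]; simp
  change HasSum (fun n => ‖fc (f - g) n‖ ^ 2) _ at hs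
  simp only [h0] at hs
  have hz := hs.unique hasSum_zero
  have hz : ∫ θ in (-Real.pi)..Real.pi, (f θ - g θ) ^ 2 = 0 := by
    have hpi := Real.pi_pos
    rcases mul_eq_zero.1 hz with h | h
    · exact absurd h (by positivity)
    · simpa using h
  have hper : Function.Periodic (fun θ => f θ - g θ) (2 * Real.pi) := fun θ => by
    simp only [hfp θ, hgp θ]
  have hlt : (-Real.pi) < Real.pi := neg_lt_self Real.pi_pos
  funext θ
  by_contra hne
  obtain ⟨ψ, hψ, hψe⟩ := hper.exists_mem_Ioc Real.two_pi_pos θ (-Real.pi)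
  rw [show -Real.pi + 2 * Real.pi = Real.pi by ring] at hψ
  have hpos := intervalIntegral.integral_pos (f := fun θ => (f θ - g θ) ^ 2) hlt
    (by fun_prop) (fun x _ => sq_nonneg _)
    ⟨ψ, Set.Ioc_subset_Icc_self hψ, by
      have : f θ - g θ ≠ 0 := sub_ne_zero.2 hne
      rw [hψe] at this
      positivity⟩
  exact hpos.ne' hz

namespace IsPeriodicC2

variable {f f' f'' : ℝ → ℝ}

lemma norm_fc_deriv (H : IsPeriodicC2 f f' f'') (n : ℤ) :
    ‖fc f' n‖ ^ 2 = (n : ℝ) ^ 2 * ‖fc f n‖ ^ 2 := by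
  have hpp : f Real.pi = f (-Real.pi) := by
    rw [← H.per (-Real.pi)]; congr 1; ring
  rcases eq_or_ne n 0 with rfl | hn
  · have : ∫ θ in (-Real.pi)..Real.pi, f' θ = 0 := by
      rw [intervalIntegral.integral_eq_sub_of_hasDerivAt (fun θ _ => H.hasDerivAt θ)
        (H.continuous'.intervalIntegrable _ _), hpp, sub_self]
    rw [fc_zero, this]
    simp
  · have h := fourierCoeffOn_of_hasDerivAt (neg_lt_self Real.pi_pos) hn
      (f := fun θ => (f θ : ℂ)) (f' := fun θ => (f' θ : ℂ))
      (fun θ _ => (H.hasDerivAt θ).ofReal_comp)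
      ((Complex.continuous_ofReal.comp H.continuous').intervalIntegrable _ _)
    simp only [hpp, sub_self, mul_zero, zero_sub] at h
    change fc f n = 1 / (-2 * Real.pi * Complex.I * n) *
      -((Real.pi - ((-Real.pi : ℝ) : ℂ)) * fc f' n) at h
    have hpi : (Real.pi : ℂ) ≠ 0 := by exact_mod_cast Real.pi_ne_zero
    have hn' : (n : ℂ) ≠ 0 := by exact_mod_cast hn
    have h2 : fc f' n = Complex.I * n * fc f n := by
      rw [h]; push_cast; field_simp [Complex.I_ne_zero]; ring
    rw [h2, norm_mul, norm_mul, Complex.norm_I, one_mul, mul_pow, Complex.norm_intCast, sq_abs]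

/-- Integration by parts turns the integral into `∫ f² - ∫ f'²`, and Parseval is applied to `f` and
`f'`. -/
lemma hasSum_area (H : IsPeriodicC2 f f' f'') :
    HasSum (fun n : ℤ => Real.pi * ((1 - (n : ℝ) ^ 2) * ‖fc f n‖ ^ 2))
      (1 / 2 * ∫ θ in (-Real.pi)..Real.pi, f θ * (f θ + f'' θ)) := by
  have h1 := (hasSum_sq_fc H.continuous).sub (hasSum_sq_fc H.continuous')
  simp only [H.norm_fc_deriv] at h1
  have h2 := h1.mul_left Real.pi
  have hpp : f Real.pi = f (-Real.pi) := by
    rw [← H.per (-Real.pi)]; congr 1; ring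
  have hpp' : f' Real.pi = f' (-Real.pi) := by
    rw [← H.per' (-Real.pi)]; congr 1; ring
  have hparts : ∫ θ in (-Real.pi)..Real.pi, f θ * f'' θ
      = - ∫ θ in (-Real.pi)..Real.pi, f' θ ^ 2 := by
    rw [intervalIntegral.integral_mul_deriv_eq_deriv_mul (fun θ _ => H.hasDerivAt θ)
      (fun θ _ => H.hasDerivAt' θ) (H.continuous'.intervalIntegrable _ _)
      (H.cont.intervalIntegrable _ _), hpp, hpp', sub_self, zero_sub]
    simp only [sq]
  have hc := H.continuous
  have hc'' := H.cont
  have hsplit : ∫ θ in (-Real.pi)..Real.pi, f θ * (f θ + f'' θ)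
      = (∫ θ in (-Real.pi)..Real.pi, f θ ^ 2) - ∫ θ in (-Real.pi)..Real.pi, f' θ ^ 2 := by
    simp only [mul_add]
    rw [intervalIntegral.integral_add (Continuous.intervalIntegrable (by fun_prop) _ _)
      (Continuous.intervalIntegrable (by fun_prop) _ _), hparts]
    simp only [← sq, sub_eq_add_neg]
  convert! h2 using 1
  · funext n; ring
  · rw [hsplit]
    have := Real.pi_ne_zero
    field_simp

end IsPeriodicC2

lemma isPeriodicC2_trigTerm (b : ℂ) (n : ℤ) :
    IsPeriodicC2 (trigTerm b n) (trigTerm (b * (n * Complex.I)) n)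
      (fun θ => -(n : ℝ) ^ 2 * trigTerm b n θ) := by
  have hd : ∀ (b : ℂ) (θ : ℝ), HasDerivAt (trigTerm b n) (trigTerm (b * (n * Complex.I)) n θ) θ := by
    intro b θ
    have h1 : HasDerivAt (fun θ : ℝ => (n * θ * Complex.I : ℂ)) (n * Complex.I) θ := by
      simpa using ((hasDerivAt_id θ).ofReal_comp.const_mul (n : ℂ)).mul_const Complex.I
    have h2 := (h1.cexp.const_mul b)
    have h3 := (Complex.reCLM.hasFDerivAt.comp_hasDerivAt θ h2).const_mul 2
    convert! h3 using 1
    simp only [trigTerm, Complex.reCLM_apply]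
    congr 2; ring
  refine ⟨hd b, fun θ => ?_, (continuous_trigTerm b n).const_mul _, fun θ => ?_⟩
  · convert! hd _ θ using 1
    rw [trigTerm, trigTerm]
    have : b * (n * Complex.I) * (n * Complex.I) * Complex.exp (n * θ * Complex.I)
        = ((-(n : ℝ) ^ 2 : ℝ) : ℂ) * (b * Complex.exp (n * θ * Complex.I)) := by
      push_cast; linear_combination (b * n ^ 2 * Complex.exp (n * θ * Complex.I)) * Complex.I_sq
    rw [this, Complex.re_ofReal_mul]; ring
  · have h := periodic_cexp_int_mul n θ
    simp only at h
    simp only [trigTerm, h]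

/-! ### Mollification -/

/-- The mollification of `h` by the normalized bump function `φ`. -/
noncomputable def mollify (φ : ContDiffBump (0 : ℝ)) (h : ℝ → ℝ) (x : ℝ) : ℝ :=
  ∫ t, φ.normed MeasureTheory.volume t * h (x - t)

section mollify

variable (φ : ContDiffBump (0 : ℝ)) {h : ℝ → ℝ}

lemma integrable_normed_mul {g : ℝ → ℝ} (hg : Continuous g) :
    MeasureTheory.Integrable (fun t => φ.normed MeasureTheory.volume t * g t) :=
  Continuous.integrable_of_hasCompactSupport (φ.continuous_normed.mul hg)
    φ.hasCompactSupport_normed.mul_right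

lemma mollify_periodic (hp : Function.Periodic h (2 * Real.pi)) :
    Function.Periodic (mollify φ h) (2 * Real.pi) := by
  intro x
  simp only [mollify]
  congr 1; ext t
  rw [show x + 2 * Real.pi - t = x - t + 2 * Real.pi by ring, hp]

lemma mollify_isPeriodicC2 (hc : Continuous h) (hp : Function.Periodic h (2 * Real.pi)) :
    IsPeriodicC2 (mollify φ h) (deriv (mollify φ h)) (deriv (deriv (mollify φ h))) := by
  have hcd : ContDiff ℝ 2 (mollify φ h) :=
    φ.hasCompactSupport_normed.contDiff_convolution_left (ContinuousLinearMap.lsmul ℝ ℝ)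
      φ.contDiff_normed hc.locallyIntegrable
  have hcd' : ContDiff ℝ 1 (deriv (mollify φ h)) := hcd.deriv'
  exact ⟨fun θ => (hcd.differentiable two_ne_zero θ).hasDerivAt,
    fun θ => (hcd'.differentiable one_ne_zero θ).hasDerivAt,
    hcd'.continuous_deriv le_rfl, mollify_periodic φ hp⟩

lemma mollify_sub_le (hc : Continuous h) {ε : ℝ} {x : ℝ}
    (hε : ∀ y ∈ Metric.ball x φ.rOut, dist (h y) (h x) ≤ ε) : |mollify φ h x - h x| ≤ ε := by
  rw [← Real.dist_eq]
  exact φ.dist_normed_convolution_le hc.aestronglyMeasurable hε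

/-- The inequality is linear in `h` and invariant under translating the angle, so it survives
averaging against a nonnegative kernel. -/
lemma two_cos_mul_mollify_le (hc : Continuous h)
    (hh : ∀ θ δ, 2 * Real.cos δ * h θ ≤ h (θ + δ) + h (θ - δ)) (θ δ : ℝ) :
    2 * Real.cos δ * mollify φ h θ ≤ mollify φ h (θ + δ) + mollify φ h (θ - δ) := by
  simp only [mollify]
  rw [← MeasureTheory.integral_add (integrable_normed_mul φ (by fun_prop))
    (integrable_normed_mul φ (by fun_prop)), ← MeasureTheory.integral_const_mul]
  refine MeasureTheory.integral_mono ((integrable_normed_mul φ (by fun_prop)).const_mul _)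
    ((integrable_normed_mul φ (by fun_prop)).add (integrable_normed_mul φ (by fun_prop))) ?_
  intro t
  have h1 := mul_le_mul_of_nonneg_left (hh (θ - t) δ) (φ.nonneg_normed (μ := MeasureTheory.volume) t)
  simp only
  rw [show θ + δ - t = θ - t + δ by ring, show θ - δ - t = θ - t - δ by ring]
  linarith

/-- The factor by which mollification multiplies the `n`-th Fourier coefficient. -/
noncomputable def mollifyFactor (n : ℤ) : ℂ :=
  ∫ t, (φ.normed MeasureTheory.volume t : ℂ) * Complex.exp (-(n * t * Complex.I))

lemma norm_mollifyFactor_le (n : ℤ) : ‖mollifyFactor φ n‖ ≤ 1 := by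
  refine (MeasureTheory.norm_integral_le_integral_norm _).trans ?_
  rw [← φ.integral_normed (μ := MeasureTheory.volume)]
  refine (MeasureTheory.integral_congr_ae (Filter.Eventually.of_forall fun t => ?_)).le
  have : -((n : ℂ) * t * Complex.I) = ((-(n * t) : ℝ) : ℂ) * Complex.I := by push_cast; ring
  simp only [norm_mul, Complex.norm_real, this, Complex.norm_exp_ofReal_mul_I, mul_one]
  exact Real.norm_of_nonneg (φ.nonneg_normed t)

lemma mollifyFactor_tendsto {φ : ℕ → ContDiffBump (0 : ℝ)}
    (hφ : Filter.Tendsto (fun k => (φ k).rOut) Filter.atTop (nhds 0)) (n : ℤ) :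
    Filter.Tendsto (fun k => mollifyFactor (φ k) n) Filter.atTop (nhds 1) := by
  -- The factor is the convolution of the bump with `t ↦ e^{int}`, evaluated at `0`.
  have h := ContDiffBump.convolution_tendsto_right_of_continuous
    (μ := (MeasureTheory.volume : MeasureTheory.Measure ℝ)) hφ
    (g := fun t : ℝ => Complex.exp (n * t * Complex.I)) (by fun_prop) 0
  convert! h using 2
  · rw [mollifyFactor, MeasureTheory.convolution_lsmul]
    congr 1; ext t
    simp
  · simp

/-- Fubini: the mollification averages translates of `h`, and translation by `-t` multiplies the
coefficient by `e^{-int}`. -/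
lemma fc_mollify (hc : Continuous h) (hp : Function.Periodic h (2 * Real.pi)) (n : ℤ) :
    fc (mollify φ h) n = mollifyFactor φ n * fc h n := by
  obtain ⟨C, hC⟩ := (hp.isBounded_of_continuous Real.two_pi_pos.ne' hc).exists_norm_le
  have hint : MeasureTheory.Integrable
      (Function.uncurry fun θ t : ℝ => Complex.exp (-(n * θ * Complex.I)) *
        ((φ.normed MeasureTheory.volume t : ℂ) * (h (θ - t) : ℂ)))
      ((MeasureTheory.volume.restrict (Set.uIoc (-Real.pi) Real.pi)).prod
        MeasureTheory.volume) := by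
    have h1 : MeasureTheory.Integrable (fun θ : ℝ => Complex.exp (-(n * θ * Complex.I)))
        (MeasureTheory.volume.restrict (Set.uIoc (-Real.pi) Real.pi)) :=
      intervalIntegrable_iff.1 (Continuous.intervalIntegrable (by fun_prop) _ _)
    have h2 : MeasureTheory.Integrable (fun t : ℝ => (φ.normed MeasureTheory.volume t : ℂ)) :=
      φ.integrable_normed.ofReal
    have h3 := (h1.mul_prod h2).mul_bdd (c := C)
      (g := fun z : ℝ × ℝ => (h (z.1 - z.2) : ℂ))
      (Continuous.aestronglyMeasurable (by fun_prop))
      (Filter.Eventually.of_forall fun z => by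
        rw [Complex.norm_real]; exact hC _ ⟨_, rfl⟩)
    convert! h3 using 1
    ext z
    simp [Function.uncurry, mul_assoc]
  have hinner : ∀ θ : ℝ, Complex.exp (-(n * θ * Complex.I)) * (mollify φ h θ : ℂ)
      = ∫ t, Complex.exp (-(n * θ * Complex.I)) *
        ((φ.normed MeasureTheory.volume t : ℂ) * (h (θ - t) : ℂ)) := by
    intro θ
    rw [MeasureTheory.integral_const_mul, mollify, ← integral_complex_ofReal]
    push_cast; rfl
  have houter : ∀ t : ℝ, (1 / (2 * Real.pi) : ℝ) * ∫ θ in (-Real.pi)..Real.pi,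
      Complex.exp (-(n * θ * Complex.I)) *
        ((φ.normed MeasureTheory.volume t : ℂ) * (h (θ - t) : ℂ))
      = (φ.normed MeasureTheory.volume t : ℂ) * Complex.exp (-(n * t * Complex.I)) * fc h n := by
    intro t
    have h1 := fc_shift hp (-t) n
    rw [fc_eq_integral] at h1
    have h2 : ∫ θ in (-Real.pi)..Real.pi, Complex.exp (-(n * θ * Complex.I)) *
        ((φ.normed MeasureTheory.volume t : ℂ) * (h (θ - t) : ℂ))
        = (φ.normed MeasureTheory.volume t : ℂ) * ∫ θ in (-Real.pi)..Real.pi,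
          Complex.exp (-(n * θ * Complex.I)) * (h (θ + -t) : ℂ) := by
      rw [← intervalIntegral.integral_const_mul]
      refine intervalIntegral.integral_congr fun θ _ => ?_
      simp only [← sub_eq_add_neg]; ring
    rw [h2, mul_left_comm, h1, ← mul_assoc,
      show (n : ℂ) * ((-t : ℝ) : ℂ) * Complex.I = -(n * t * Complex.I) by push_cast; ring]
  rw [fc_eq_integral]
  simp only [hinner]
  rw [MeasureTheory.intervalIntegral_integral_swap hint, ← MeasureTheory.integral_const_mul]
  simp only [houter]
  rw [MeasureTheory.integral_mul_const, mollifyFactor]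

end mollify

/-- A `C²` function satisfying the sublinearity inequality of support functions has
`f + f'' ≥ 0`. -/
lemma IsPeriodicC2.add_nonneg_of_two_cos_mul_le {f f' f'' : ℝ → ℝ} (H : IsPeriodicC2 f f' f'')
    (hf : ∀ θ δ, 2 * Real.cos δ * f θ ≤ f (θ + δ) + f (θ - δ)) (θ : ℝ) : 0 ≤ f θ + f'' θ := by
  -- `G` has its minimum `0` at `δ = 0`, with `G''(0) = 2 (f + f'')(θ)`. A negative value would make
  -- `0` a local maximum too, hence `G` locally constant with `G''(0) = 0`.
  set G : ℝ → ℝ := fun δ => f (θ + δ) + f (θ - δ) - 2 * Real.cos δ * f θ with hG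
  have hG0 : G 0 = 0 := by simp [hG]; ring
  have hGnn : ∀ δ, 0 ≤ G δ := fun δ => sub_nonneg.2 (hf θ δ)
  have hd1 : ∀ δ, HasDerivAt G (f' (θ + δ) - f' (θ - δ) + 2 * Real.sin δ * f θ) δ := by
    intro δ
    have h1 := (H.hasDerivAt (θ + δ)).comp_const_add θ δ
    have h2 := (H.hasDerivAt (θ - δ)).comp_const_sub θ δ
    convert! (h1.add h2).sub (((Real.hasDerivAt_cos δ).const_mul 2).mul_const (f θ)) using 1
    ring
  have hd2 : HasDerivAt (deriv G) (2 * (f θ + f'' θ)) 0 := by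
    rw [show deriv G = fun δ => f' (θ + δ) - f' (θ - δ) + 2 * Real.sin δ * f θ from
      funext fun δ => (hd1 δ).deriv]
    have h1 := (H.hasDerivAt' (θ + 0)).comp_const_add θ 0
    have h2 := (H.hasDerivAt' (θ - 0)).comp_const_sub θ 0
    convert! (h1.sub h2).add (((Real.hasDerivAt_sin 0).const_mul 2).mul_const (f θ)) using 1
    simp; ring
  by_contra! hneg
  have hmax : IsLocalMax G 0 := isLocalMax_of_deriv_deriv_neg
    (by rw [hd2.deriv]; linarith) (by rw [(hd1 0).deriv]; simp) (hd1 0).continuousAt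
  have hev : G =ᶠ[nhds 0] fun _ => 0 := by
    filter_upwards [hmax] with δ hδ
    exact le_antisymm (hG0 ▸ hδ) (hGnn δ)
  have h0 : deriv (deriv G) 0 = 0 := by
    rw [hev.deriv.deriv_eq]; simp
  rw [hd2.deriv] at h0
  linarith

/-! ### Quantitative comparison of bodies and passage to the limit -/

lemma exists_lipschitz_supportFn (K : ConvexBody Plane) :
    ∃ C : ℝ, 0 ≤ C ∧ ∀ θ ψ, |supportFn K θ - supportFn K ψ| ≤ C * |θ - ψ| := by
  obtain ⟨R, hR⟩ := K.isCompact.isBounded.exists_norm_le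
  have key : ∀ θ ψ, supportFn K θ - supportFn K ψ ≤ (R + R) * |θ - ψ| := by
    intro θ ψ
    obtain ⟨x, hx, hxθ⟩ := exists_inner_eq_supportFn K θ
    have h1 := inner_le_supportFn hx ψ
    rw [← hxθ]
    rw [inner_unitVec] at h1 ⊢
    have hxn := hR x hx
    have a0 : |x 0| ≤ R := (PiLp.norm_apply_le x 0).trans hxn
    have a1 : |x 1| ≤ R := (PiLp.norm_apply_le x 1).trans hxn
    have b0 := mul_le_mul (Real.abs_cos_sub_cos_le θ ψ) a0 (abs_nonneg _) (abs_nonneg _)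
    have b1 := mul_le_mul (Real.abs_sin_sub_sin_le θ ψ) a1 (abs_nonneg _) (abs_nonneg _)
    rw [← abs_mul] at b0 b1
    have c0 := le_abs_self ((Real.cos θ - Real.cos ψ) * x 0)
    have c1 := le_abs_self ((Real.sin θ - Real.sin ψ) * x 1)
    nlinarith
  have hR0 : 0 ≤ R := by
    obtain ⟨x, hx⟩ := K.nonempty
    exact (norm_nonneg x).trans (hR x hx)
  refine ⟨R + R, by linarith, fun θ ψ => abs_sub_le_iff.2 ⟨key θ ψ, ?_⟩⟩
  rw [abs_sub_comm]; exact key ψ θ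

/-- The parallel body `K + cB` has support function at least `h_K + c`, so it contains `L`. -/
lemma subset_cthickening_of_supportFn_le {K L : ConvexBody Plane} {c : ℝ} (hc : 0 ≤ c)
    (h : ∀ θ, supportFn L θ ≤ supportFn K θ + c) :
    (L : Set Plane) ⊆ Metric.cthickening c (K : Set Plane) := by
  let N : ConvexBody Plane :=
    { carrier := (K : Set Plane) + Metric.closedBall 0 c
      convex' := K.convex.add (convex_closedBall 0 c)
      isCompact' := K.isCompact.add (isCompact_closedBall 0 c)
      nonempty' := K.nonempty.add (Metric.nonempty_closedBall.2 hc) }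
  have hN : (N : Set Plane) = Metric.cthickening c (K : Set Plane) :=
    K.isCompact.add_closedBall_zero hc
  rw [← hN]
  refine subset_of_supportFn_le fun θ => (h θ).trans ?_
  obtain ⟨x, hx, hxθ⟩ := exists_inner_eq_supportFn K θ
  have hu : (inner ℝ (unitVec θ) (unitVec θ) : ℝ) = 1 := by
    rw [inner_unitVec]; simp [unitVec]; nlinarith [Real.sin_sq_add_cos_sq θ]
  have hn : ‖unitVec θ‖ = 1 := by
    rw [norm_eq_sqrt_real_inner, hu, Real.sqrt_one]
  have hmem : x + c • unitVec θ ∈ (N : Set Plane) := by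
    refine Set.add_mem_add hx ?_
    rw [mem_closedBall_zero_iff, norm_smul, hn, mul_one, Real.norm_of_nonneg hc]
  have h1 := inner_le_supportFn hmem θ
  rwa [inner_add_right, inner_smul_right, hu, mul_one, hxθ] at h1

/-- Removing summation weights that tend to `1`. -/
lemma hasSum_of_tendsto_weights {ι : Type*} {a : ι → ℝ} {w : ℕ → ι → ℝ} {S : ℕ → ℝ} {T : ℝ}
    (ha : ∀ i, 0 ≤ a i) (hw0 : ∀ k i, 0 ≤ w k i) (hw1 : ∀ k i, w k i ≤ 1)
    (hw : ∀ i, Filter.Tendsto (fun k => w k i) Filter.atTop (nhds 1))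
    (hS : ∀ k, HasSum (fun i => w k i * a i) (S k))
    (hT : Filter.Tendsto S Filter.atTop (nhds T)) : HasSum a T := by
  -- Finite sums pass to the limit termwise, which yields summability and `∑ a ≤ T`. The reverse
  -- inequality uses that the weights are at most `1`.
  have hfin : ∀ s : Finset ι, ∑ i ∈ s, a i ≤ T := by
    intro s
    have h1 : Filter.Tendsto (fun k => ∑ i ∈ s, w k i * a i) Filter.atTop
        (nhds (∑ i ∈ s, 1 * a i)) :=
      tendsto_finsetSum _ fun i _ => (hw i).mul_const _
    simp only [one_mul] at h1
    exact le_of_tendsto_of_tendsto' h1 hT fun k =>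
      sum_le_hasSum s (fun i _ => mul_nonneg (hw0 k i) (ha i)) (hS k)
  have hsum : Summable a := summable_of_sum_le ha hfin
  have h2 : T ≤ ∑' i, a i := le_of_tendsto' hT fun k =>
    hasSum_le (fun i => mul_le_of_le_one_left (ha i) (hw1 k i)) (hS k) hsum.hasSum
  have h3 : ∑' i, a i ≤ T := hsum.tsum_le_of_sum_le hfin
  rw [le_antisymm h2 h3]
  exact hsum.hasSum

/-! ### The area of a convex body in terms of its support function -/

lemma inner_unitVec_eq_trigTerm (v : Plane) (θ : ℝ) :
    inner ℝ (unitVec θ) v = trigTerm ⟨v 0 / 2, -(v 1 / 2)⟩ 1 θ := by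
  have : Complex.exp (((1 : ℤ) : ℂ) * θ * Complex.I) = ⟨Real.cos θ, Real.sin θ⟩ := by
    rw [Int.cast_one, one_mul, Complex.exp_mul_I, ← Complex.ofReal_cos, ← Complex.ofReal_sin]
    apply Complex.ext <;> simp [-Complex.ofReal_cos, -Complex.ofReal_sin]
  rw [inner_unitVec, trigTerm, this, Complex.mul_re]
  ring

lemma fc_inner_unitVec (v : Plane) {n : ℤ} (h1 : n ≠ 1) (h2 : n ≠ -1) :
    fc (fun θ => inner ℝ (unitVec θ) v) n = 0 := by
  simp only [inner_unitVec_eq_trigTerm]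
  rw [show (fun θ => trigTerm _ 1 θ) = trigTerm ⟨v 0 / 2, -(v 1 / 2)⟩ 1 from rfl, fc_trigTerm]
  simp [h1, h2]

lemma continuous_inner_unitVec_left (v : Plane) :
    Continuous fun θ => (inner ℝ (unitVec θ) v : ℝ) := by
  simp only [inner_unitVec]; fun_prop

lemma const_eq_trigTerm (c : ℝ) : (fun _ => c) = trigTerm ((c / 2 : ℝ) : ℂ) 0 := by
  funext θ
  simp only [trigTerm]
  simp; ring

lemma isPeriodicC2_const (c : ℝ) : IsPeriodicC2 (fun _ => c) (fun _ => 0) (fun _ => 0) :=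
  ⟨fun θ => hasDerivAt_const θ c, fun θ => hasDerivAt_const θ 0, continuous_const, fun _ => rfl⟩

lemma fc_const (c : ℝ) (n : ℤ) : fc (fun _ => c) n = if n = 0 then (c : ℂ) else 0 := by
  rw [const_eq_trigTerm, fc_trigTerm, neg_zero]
  split_ifs with h
  · rw [Complex.conj_ofReal, ← Complex.ofReal_add, add_halves]
  · simp

/-- A convex body containing the origin is a limit of bodies with smooth support function, obtained
by mollifying its support function. -/
lemma exists_mollified_body {K : ConvexBody Plane} (h0 : (0 : Plane) ∈ (K : Set Plane)) {ε : ℝ}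
    (hε : 0 < ε) : ∃ φ : ContDiffBump (0 : ℝ), φ.rOut ≤ ε ∧ ∃ L : ConvexBody Plane,
      (K : Set Plane) ⊆ L ∧ (L : Set Plane) ⊆ Metric.cthickening (3 * ε) K ∧
      HasSum (fun n : ℤ => Real.pi * ((1 - (n : ℝ) ^ 2) *
        ‖mollifyFactor φ n * fc (supportFn K) n + if n = 0 then ((2 * ε : ℝ) : ℂ) else 0‖ ^ 2))
        (MeasureTheory.volume.real (L : Set Plane)) := by
  obtain ⟨C, hC0, hC⟩ := exists_lipschitz_supportFn K
  -- A bump of radius `r` moves a `C`-Lipschitz function by at most `ε`; `C + 1` keeps the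
  -- denominator positive.
  set r := ε / (C + 1) with hr
  have hrpos : 0 < r := by positivity
  have hrε : r ≤ ε := div_le_self hε.le (by linarith)
  let φ : ContDiffBump (0 : ℝ) := ⟨r / 2, r, half_pos hrpos, half_lt_self hrpos⟩
  have hc := continuous_supportFn K
  have hp := periodic_supportFn K
  have hh0 : ∀ θ, 0 ≤ supportFn K θ := fun θ => by
    simpa using inner_le_supportFn h0 θ
  have hclose : ∀ θ, |mollify φ (supportFn K) θ - supportFn K θ| ≤ ε := fun θ => by
    refine mollify_sub_le φ hc fun y hy => ?_
    rw [Real.dist_eq]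
    have hyr : |y - θ| < r := by simpa [Real.dist_eq] using! hy
    calc |supportFn K y - supportFn K θ| ≤ C * |y - θ| := hC y θ
      _ ≤ (C + 1) * r := mul_le_mul (by linarith) hyr.le (abs_nonneg _) (by linarith)
      _ = ε := by rw [hr]; field_simp
  have H := mollify_isPeriodicC2 φ hc hp
  -- Adding `2ε` beats the mollification error `ε`: the function and its `f + f''` become strictly
  -- positive, `L` contains `K`, and the total excess is at most `3ε`.
  have H2 := H.add (isPeriodicC2_const (2 * ε))
  have hnn := H.add_nonneg_of_two_cos_mul_le
    (two_cos_mul_mollify_le φ hc (two_cos_mul_supportFn_le K))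
  have hpos : ∀ θ, 0 < mollify φ (supportFn K) θ + 2 * ε
      + (deriv (deriv (mollify φ (supportFn K))) θ + 0) := fun θ => by
    linarith [hnn θ]
  have hfpos : ∀ θ, 0 < mollify φ (supportFn K) θ + 2 * ε := fun θ => by
    linarith [hh0 θ, (abs_le.1 (hclose θ)).1]
  obtain ⟨L, hL⟩ := H2.exists_supportFn_eq fun θ => (hpos θ).le
  refine ⟨φ, hrε, L, ?_, ?_, ?_⟩
  · refine subset_of_supportFn_le fun θ => ?_
    rw [hL]; linarith [(abs_le.1 (hclose θ)).1]
  · refine subset_cthickening_of_supportFn_le (by linarith) fun θ => ?_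
    rw [hL]; linarith [(abs_le.1 (hclose θ)).2]
  · rw [H2.volume_real_eq hfpos hpos hL]
    have h := H2.hasSum_area
    simpa only [fc_add H.continuous continuous_const, fc_mollify φ hc hp, fc_const] using h

lemma hasSum_volume_of_zero_mem {K : ConvexBody Plane} (h0 : (0 : Plane) ∈ (K : Set Plane)) :
    HasSum (fun n : ℤ => Real.pi * ((1 - (n : ℝ) ^ 2) * ‖fc (supportFn K) n‖ ^ 2))
      (MeasureTheory.volume.real (K : Set Plane)) := by
  set V := MeasureTheory.volume.real (K : Set Plane) with hV
  set c : ℤ → ℂ := fc (supportFn K) with hc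
  let ε : ℕ → ℝ := fun k => 1 / ((k : ℝ) + 1)
  have hε : ∀ k, 0 < ε k := fun k => by positivity
  have hεt : Filter.Tendsto ε Filter.atTop (nhds 0) := tendsto_one_div_add_atTop_nhds_zero_nat
  choose φ hφ L hKL hLK hsum using fun k => exists_mollified_body h0 (hε k)
  have hφt : Filter.Tendsto (fun k => (φ k).rOut) Filter.atTop (nhds 0) :=
    squeeze_zero (fun k => (φ k).rOut_pos.le) hφ hεt
  have hm := fun n => mollifyFactor_tendsto hφt n
  have hvol : Filter.Tendsto (fun k => MeasureTheory.volume.real (L k : Set Plane)) Filter.atTop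
      (nhds V) := by
    have hcth : Filter.Tendsto (fun k => MeasureTheory.volume.real
        (Metric.cthickening (3 * ε k) (K : Set Plane))) Filter.atTop (nhds V) := by
      have h1 : Filter.Tendsto (fun k => 3 * ε k) Filter.atTop (nhds 0) := by
        simpa using hεt.const_mul 3
      have h2 := (tendsto_measure_cthickening_of_isCompact
        (μ := (MeasureTheory.volume : MeasureTheory.Measure Plane)) K.isCompact).comp h1
      exact (ENNReal.tendsto_toReal K.isCompact.measure_lt_top.ne).comp h2
    refine tendsto_of_tendsto_of_tendsto_of_le_of_le tendsto_const_nhds hcth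
      (fun k => ?_) (fun k => ?_)
    · exact MeasureTheory.measureReal_mono (hKL k) (L k).isCompact.measure_lt_top.ne
    · exact MeasureTheory.measureReal_mono (hLK k)
        (K.isCompact.isBounded.cthickening.measure_lt_top.ne)
  -- Only the term `n = 0` of the area series is positive. Setting it aside and changing sign leaves
  -- nonnegative terms, as the limit of weights requires; the added constant `2ε` also affects only
  -- `n = 0`.
  let a : ℤ → ℝ := fun n => if n = 0 then 0 else Real.pi * (((n : ℝ) ^ 2 - 1) * ‖c n‖ ^ 2)
  have ha : ∀ n, 0 ≤ a n := fun n => by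
    simp only [a]
    split_ifs with h
    · exact le_rfl
    · have h1 : (1 : ℝ) ≤ (n : ℝ) ^ 2 := by
        have h2 : 1 ≤ n ^ 2 := Int.one_le_abs h |>.trans (by
          rw [← sq_abs]; nlinarith [Int.one_le_abs h])
        exact_mod_cast h2
      have := Real.pi_pos
      have h3 : 0 ≤ (n : ℝ) ^ 2 - 1 := by linarith
      positivity
  have hS : ∀ k, HasSum (fun n => ‖mollifyFactor (φ k) n‖ ^ 2 * a n)
      (Real.pi * ‖mollifyFactor (φ k) 0 * c 0 + ((2 * ε k : ℝ) : ℂ)‖ ^ 2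
        - MeasureTheory.volume.real (L k : Set Plane)) := by
    intro k
    have h1 := (hasSum_ite_sub_hasSum (hsum k) 0).neg
    convert! h1 using 1
    · funext n
      simp only [a]
      split_ifs with h
      · simp
      · rw [add_zero, norm_mul]; ring
    · simp [hc]
  have hT : Filter.Tendsto (fun k =>
      Real.pi * ‖mollifyFactor (φ k) 0 * c 0 + ((2 * ε k : ℝ) : ℂ)‖ ^ 2
        - MeasureTheory.volume.real (L k : Set Plane)) Filter.atTop
      (nhds (Real.pi * ‖1 * c 0 + ((2 * 0 : ℝ) : ℂ)‖ ^ 2 - V)) :=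
    ((((((hm 0).mul_const (c 0)).add
      ((Complex.continuous_ofReal.tendsto _).comp (hεt.const_mul 2))).norm).pow 2).const_mul _).sub
      hvol
  have hmain := hasSum_of_tendsto_weights (w := fun k n => ‖mollifyFactor (φ k) n‖ ^ 2) ha
    (fun k n => sq_nonneg _)
    (fun k n => pow_le_one₀ (norm_nonneg _) (norm_mollifyFactor_le (φ k) n))
    (fun n => by simpa using ((hm n).norm).pow 2) hS hT
  have h2 := (hasSum_ite_eq (0 : ℤ) (Real.pi * ‖c 0‖ ^ 2)).sub hmain
  convert! h2 using 1
  · funext n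
    simp only [a]
    split_ifs with h
    · simp [h]
    · ring
  · simp

lemma coe_motion (M : ConvexBody Plane) (R : Matrix (Fin 2) (Fin 2) ℝ) (v : Plane) :
    (M.motion R v : Set Plane) = (fun x => matAct R x + v) '' (M : Set Plane) := rfl

lemma supportFn_motion (M : ConvexBody Plane) (φ : ℝ) (v : Plane) (θ : ℝ) :
    supportFn (M.motion (rotMat φ) v) θ = supportFn M (θ - φ) + inner ℝ (unitVec θ) v :=
  supportFn_image_add (σ := fun θ => θ - φ) (fun θ x => inner_unitVec_rotMat φ θ x)
    (coe_motion M _ v) θ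

lemma matAct_rotMat_zero (x : Plane) : matAct (rotMat 0) x = x := by
  ext i; fin_cases i <;> simp [matAct_apply, rotMat]

/-- The area of a convex body is `π ∑ (1 - n²) |c_n|²`. -/
lemma hasSum_volume (K : ConvexBody Plane) :
    HasSum (fun n : ℤ => Real.pi * ((1 - (n : ℝ) ^ 2) * ‖fc (supportFn K) n‖ ^ 2))
      (MeasureTheory.volume.real (K : Set Plane)) := by
  obtain ⟨x, hx⟩ := K.nonempty
  -- Translating a point of `K` to the origin changes only `c_{±1}`, whose weights `1 - n²` vanish.
  have h := hasSum_volume_of_zero_mem (K := K.motion (rotMat 0) (-x))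
    ⟨x, hx, by simp [matAct_rotMat_zero]⟩
  have hs : supportFn (K.motion (rotMat 0) (-x))
      = fun θ => supportFn K θ + inner ℝ (unitVec θ) (-x) := by
    funext θ; rw [supportFn_motion, sub_zero]
  convert! h using 1
  · funext n
    by_cases h1 : n = 1
    · simp [h1]
    by_cases h2 : n = -1
    · simp [h2]
    rw [hs, fc_add (continuous_supportFn K) (continuous_inner_unitVec_left _),
      fc_inner_unitVec _ h1 h2, add_zero]
  · simp only [coe_motion, matAct_rotMat_zero]
    rw [Set.image_add_right, MeasureTheory.measureReal_def, MeasureTheory.measureReal_def,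
      MeasureTheory.measure_preimage_add_right]

/-! ### The excluded area function -/

/-- The excluded area at the rotation by `π - ψ`, as a cosine series. -/
lemma hasSum_excludedArea (M : ConvexBody Plane) (ψ : ℝ) :
    HasSum (fun n : ℤ => 2 * Real.pi * ((1 - (n : ℝ) ^ 2) * ‖fc (supportFn M) n‖ ^ 2) *
      (1 + Real.cos (n * ψ))) (excludedArea M ⟨rotMat (Real.pi - ψ), rotMat_mem _⟩) := by
  have h := hasSum_volume (M.subRot (rotMat (Real.pi - ψ)))
  have hs : supportFn (M.subRot (rotMat (Real.pi - ψ)))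
      = fun θ => supportFn M θ + supportFn M (θ + ψ) := by
    funext θ; rw [supportFn_subRot, sub_sub_cancel]
  have hc := continuous_supportFn M
  convert! h using 1
  funext n
  rw [hs, fc_add hc (by fun_prop), fc_shift (periodic_supportFn M), ← one_add_mul, norm_mul,
    mul_pow]
  have h1 : ‖1 + Complex.exp (n * ψ * Complex.I)‖ ^ 2 = 2 * (1 + Real.cos (n * ψ)) := by
    rw [show ((n : ℂ) * ψ) = ((n * ψ : ℝ) : ℂ) by push_cast; ring, ← Complex.normSq_eq_norm_sq,
      Complex.normSq_apply]
    simp only [Complex.add_re, Complex.add_im, Complex.one_re, Complex.one_im,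
      Complex.exp_ofReal_mul_I_re, Complex.exp_ofReal_mul_I_im]
    nlinarith [Real.sin_sq_add_cos_sq (n * ψ)]
  rw [h1]; ring

lemma excludedArea_eq_of_norm_fc_eq {M M' : ConvexBody Plane}
    (h : ∀ n : ℤ, n ≠ 1 → n ≠ -1 → ‖fc (supportFn M) n‖ = ‖fc (supportFn M') n‖) :
    excludedArea M = excludedArea M' := by
  funext ⟨R, hR⟩
  obtain ⟨φ, rfl⟩ := exists_eq_rotMat hR
  have h1 := hasSum_excludedArea M (Real.pi - φ)
  have h2 := hasSum_excludedArea M' (Real.pi - φ)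
  simp only [sub_sub_cancel] at h1 h2
  refine h1.unique ?_
  convert! h2 using 1
  funext n
  by_cases h3 : n = 1
  · simp [h3]
  by_cases h4 : n = -1
  · simp [h4]
  rw [h n h3 h4]

/-- Fourier coefficients of a uniformly absolutely convergent series of functions. -/
lemma hasSum_fc {ι : Type*} [Countable ι] {F : ι → ℝ → ℝ} {b : ι → ℝ} {f : ℝ → ℝ}
    (hF : ∀ i, Continuous (F i)) (hb : ∀ i t, |F i t| ≤ b i) (hs : Summable b)
    (hf : ∀ t, HasSum (fun i => F i t) (f t)) (m : ℤ) :
    HasSum (fun i => fc (F i) m) (fc f m) := by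
  simp only [fc_eq_integral]
  refine HasSum.mul_left _ ?_
  refine intervalIntegral.hasSum_integral_of_dominated_convergence (fun i _ => b i)
    (fun i => ?_) (fun i => ?_) ?_ ?_ ?_
  · have := hF i
    exact Continuous.aestronglyMeasurable (by fun_prop)
  · refine Filter.Eventually.of_forall fun t _ => ?_
    have : -((m : ℂ) * t * Complex.I) = ((-(m * t) : ℝ) : ℂ) * Complex.I := by push_cast; ring
    rw [norm_mul, this, Complex.norm_exp_ofReal_mul_I, one_mul, Complex.norm_real]
    exact hb i t
  · exact Filter.Eventually.of_forall fun _ _ => hs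
  · exact intervalIntegrable_const
  · exact Filter.Eventually.of_forall fun t _ => (Complex.hasSum_ofReal.2 (hf t)).mul_left _

lemma cos_int_mul_eq_trigTerm (n : ℤ) :
    (fun ψ : ℝ => Real.cos (n * ψ)) = trigTerm ((1 / 2 : ℝ) : ℂ) n := by
  funext ψ
  rw [trigTerm, Complex.re_ofReal_mul,
    show ((n : ℂ) * ψ) = ((n * ψ : ℝ) : ℂ) by push_cast; ring, Complex.exp_ofReal_mul_I_re]
  ring

/-- For `m ≠ 0` the `m`-th Fourier coefficient of the sum is `d m`, the indices `m` and `-m`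
contributing half each. With those terms gone, `ψ = 0` leaves `2 d 0 = 0`. -/
lemma eq_zero_of_hasSum_one_add_cos {d : ℤ → ℝ} (hd : ∀ n, d (-n) = d n) (hs : Summable d)
    (h : ∀ ψ : ℝ, HasSum (fun n : ℤ => d n * (1 + Real.cos (n * ψ))) 0) (n : ℤ) : d n = 0 := by
  have hne : ∀ m : ℤ, m ≠ 0 → d m = 0 := by
    intro m hm
    have h1 := hasSum_fc (F := fun (n : ℤ) ψ => d n * (1 + Real.cos (n * ψ)))
      (b := fun n => |d n| * 2) (f := fun _ => 0) (fun n => by fun_prop)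
      (fun n ψ => by
        rw [abs_mul]
        refine mul_le_mul_of_nonneg_left ?_ (abs_nonneg _)
        rw [abs_le]
        constructor <;> linarith [Real.cos_le_one (n * ψ), Real.neg_one_le_cos (n * ψ)])
      (hs.abs.mul_right 2) h m
    have h2 : ∀ n : ℤ, fc (fun ψ => d n * (1 + Real.cos (n * ψ))) m
        = (if n = m then (d m / 2 : ℂ) else 0) + (if n = -m then (d m / 2 : ℂ) else 0) := by
      intro n
      rw [fc_const_mul, fc_add continuous_const (by fun_prop), fc_const, if_neg hm, zero_add,
        cos_int_mul_eq_trigTerm, fc_trigTerm, Complex.conj_ofReal]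
      simp only [eq_comm (a := m), neg_eq_iff_eq_neg (a := n)]
      by_cases h3 : n = m
      · by_cases h4 : n = -m
        · omega
        · simp [h3, hm, self_eq_neg]; ring
      · by_cases h4 : n = -m
        · simp [h4, hd, eq_comm, hm, self_eq_neg]; ring
        · simp [h3, h4]
    simp only [h2, fc_const] at h1
    have h3 := h1.unique ((hasSum_ite_eq m (d m / 2 : ℂ)).add (hasSum_ite_eq (-m) (d m / 2 : ℂ)))
    rw [add_halves, if_neg hm] at h3
    exact_mod_cast h3.symm
  by_cases hn : n = 0
  · have h0 := h 0
    have h1 := hasSum_single (f := fun n : ℤ => d n * (1 + Real.cos (n * 0))) 0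
      (fun m hm => by rw [hne m hm, zero_mul])
    have := h0.unique h1
    simp at this
    rw [hn, this]
  · exact hne n hn

lemma norm_fc_eq_of_excludedArea_eq {M M' : ConvexBody Plane}
    (h : excludedArea M = excludedArea M') {n : ℤ} (h1 : n ≠ 1) (h2 : n ≠ -1) :
    ‖fc (supportFn M) n‖ = ‖fc (supportFn M') n‖ := by
  have hd := eq_zero_of_hasSum_one_add_cos
    (d := fun n => 2 * Real.pi * ((1 - (n : ℝ) ^ 2) * ‖fc (supportFn M) n‖ ^ 2)
      - 2 * Real.pi * ((1 - (n : ℝ) ^ 2) * ‖fc (supportFn M') n‖ ^ 2))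
    (fun n => by simp only [norm_fc_neg]; push_cast; ring)
    (by
      have := ((hasSum_volume M).summable.sub (hasSum_volume M').summable).mul_left 2
      refine this.congr fun n => ?_
      ring)
    (fun ψ => by
      have := (hasSum_excludedArea M ψ).sub (hasSum_excludedArea M' ψ)
      rw [h, sub_self] at this
      refine this.congr_fun ?_
      intro n
      ring) n
  have h3 : (1 - (n : ℝ) ^ 2) ≠ 0 := by
    intro h4
    have h5 : ((n - 1) * (n + 1) : ℝ) = 0 := by linear_combination -h4
    rcases mul_eq_zero.1 h5 with h6 | h6
    · exact h1 (by exact_mod_cast sub_eq_zero.1 h6)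
    · exact h2 (by exact_mod_cast eq_neg_of_add_eq_zero_left h6)
  have h4 : 2 * Real.pi * (1 - (n : ℝ) ^ 2) *
      (‖fc (supportFn M) n‖ ^ 2 - ‖fc (supportFn M') n‖ ^ 2) = 0 := by linear_combination hd
  have h5 := (mul_eq_zero.1 h4).resolve_left
    (mul_ne_zero (mul_ne_zero two_ne_zero Real.pi_ne_zero) h3)
  exact (sq_eq_sq₀ (norm_nonneg _) (norm_nonneg _)).1 (sub_eq_zero.1 h5)

/-! ### Rigid motions and Fourier coefficients -/

lemma fc_rotate_add (M : ConvexBody Plane) (φ : ℝ) (v : Plane) (n : ℤ) :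
    fc (fun θ => supportFn M (θ - φ) + inner ℝ (unitVec θ) v) n
      = Complex.exp (-(n * φ * Complex.I)) * fc (supportFn M) n
        + fc (fun θ => inner ℝ (unitVec θ) v) n := by
  have hc := continuous_supportFn M
  rw [fc_add (by fun_prop) (continuous_inner_unitVec_left v)]
  congr 1
  have := fc_shift (periodic_supportFn M) (-φ) n
  simp only [← sub_eq_add_neg] at this
  rw [this]
  congr 2
  push_cast; ring

lemma fc_of_isCongruentTo {M M' : ConvexBody Plane} (h : IsCongruentTo M' M) :
    ∃ φ : ℝ, (∀ n : ℤ, n ≠ 1 → n ≠ -1 → fc (supportFn M') n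
        = Complex.exp (-(n * φ * Complex.I)) * fc (supportFn M) n) ∨
      (∀ n : ℤ, n ≠ 1 → n ≠ -1 → fc (supportFn M') n
        = Complex.exp (-(n * φ * Complex.I)) * (starRingEnd ℂ) (fc (supportFn M) n)) := by
  obtain ⟨R, hR, v, hv⟩ := h
  rcases exists_eq_rotMat_or_reflMat hR with ⟨φ, rfl⟩ | ⟨-, φ, rfl⟩
  · refine ⟨φ, Or.inl fun n h1 h2 => ?_⟩
    have hs : supportFn M' = fun θ => supportFn M (θ - φ) + inner ℝ (unitVec θ) v :=
      funext fun θ => supportFn_image_add (σ := fun θ => θ - φ)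
        (fun θ x => inner_unitVec_rotMat φ θ x) hv θ
    rw [hs, fc_rotate_add, fc_inner_unitVec v h1 h2, add_zero]
  · refine ⟨φ, Or.inr fun n h1 h2 => ?_⟩
    have hc := continuous_supportFn M
    have hs : supportFn M' = fun θ => supportFn M (-θ + φ) + inner ℝ (unitVec θ) v := by
      funext θ
      rw [supportFn_image_add (σ := fun θ => φ - θ)
        (fun θ x => inner_unitVec_reflMat φ θ x) hv θ, neg_add_eq_sub]
    rw [hs, fc_add (by fun_prop) (continuous_inner_unitVec_left v), fc_inner_unitVec v h1 h2,
      add_zero, fc_comp_neg (fun t => supportFn M (t + φ)), fc_shift (periodic_supportFn M), fc_neg]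
    congr 2
    push_cast; ring

/-- The mean of a support function is nonnegative. -/
lemma exists_fc_zero_eq (M : ConvexBody Plane) :
    ∃ r : ℝ, 0 ≤ r ∧ fc (supportFn M) 0 = r := by
  have hc := continuous_supportFn M
  -- The average of two shifted copies has the same mean, and `h(θ + π/2) + h(θ - π/2)` is a width,
  -- nonnegative by sublinearity with `δ = π/2`.
  refine ⟨1 / 2 * (1 / (2 * Real.pi) * ∫ θ in (-Real.pi)..Real.pi,
    (supportFn M (θ + Real.pi / 2) + supportFn M (θ + -(Real.pi / 2)))), ?_, ?_⟩
  · have hpi := Real.pi_pos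
    have : 0 ≤ ∫ θ in (-Real.pi)..Real.pi,
        (supportFn M (θ + Real.pi / 2) + supportFn M (θ + -(Real.pi / 2))) := by
      refine intervalIntegral.integral_nonneg (by linarith) fun θ _ => ?_
      have := two_cos_mul_supportFn_le M θ (Real.pi / 2)
      rw [Real.cos_pi_div_two] at this
      rw [← sub_eq_add_neg]
      linarith
    positivity
  · have h := fc_zero (fun θ => supportFn M (θ + Real.pi / 2) + supportFn M (θ + -(Real.pi / 2)))
    rw [fc_add (by fun_prop) (by fun_prop), fc_shift (periodic_supportFn M),
      fc_shift (periodic_supportFn M)] at h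
    rw [Complex.ofReal_mul, ← h]
    simp; ring

lemma supportFn_eq_of_fc_eq {M M' : ConvexBody Plane}
    (h : ∀ n : ℤ, 0 ≤ n → fc (supportFn M) n = fc (supportFn M') n) :
    supportFn M = supportFn M' := by
  refine eq_of_fc_eq (continuous_supportFn M) (continuous_supportFn M') (periodic_supportFn M)
    (periodic_supportFn M') fun n => ?_
  rcases le_total 0 n with hn | hn
  · exact h n hn
  · have := h (-n) (by omega)
    rw [← neg_neg n, fc_neg, this, ← fc_neg]

/-- If at most one Fourier coefficient of index at least `2` is nonzero, the excluded area
determines the body up to a rigid motion. -/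
lemma isRigidMotionOf_of_excludedArea_eq {M M' : ConvexBody Plane}
    (h : excludedArea M = excludedArea M')
    (hM : ∀ m n : ℤ, 2 ≤ m → m < n → fc (supportFn M) m ≠ 0 → fc (supportFn M) n = 0) :
    IsRigidMotionOf M' M := by
  have hnorm : ∀ n : ℤ, n ≠ 1 → n ≠ -1 → ‖fc (supportFn M) n‖ = ‖fc (supportFn M') n‖ :=
    fun n h1 h2 => norm_fc_eq_of_excludedArea_eq h h1 h2
  have hzero : ∀ k : ℤ, 2 ≤ k → fc (supportFn M) k = 0 → fc (supportFn M') k = 0 := by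
    intro k hk h0
    rw [← norm_eq_zero, ← hnorm k (by omega) (by omega), h0, norm_zero]
  obtain ⟨φ, hφ⟩ : ∃ φ : ℝ, ∀ k : ℤ, 2 ≤ k →
      fc (supportFn M') k = Complex.exp (-(k * φ * Complex.I)) * fc (supportFn M) k := by
    by_cases hex : ∃ n : ℤ, 2 ≤ n ∧ fc (supportFn M) n ≠ 0
    · obtain ⟨n, hn, hn0⟩ := hex
      have hq : ‖fc (supportFn M') n / fc (supportFn M) n‖ = 1 := by
        rw [norm_div, ← hnorm n (by omega) (by omega), div_self (norm_ne_zero_iff.2 hn0)]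
      have hexp := Complex.norm_mul_exp_arg_mul_I (fc (supportFn M') n / fc (supportFn M) n)
      rw [hq, Complex.ofReal_one, one_mul] at hexp
      -- This angle makes `e^{-inφ}` the unimodular ratio of the two `n`-th coefficients; every
      -- other coefficient of index at least `2` is zero for both bodies.
      refine ⟨-(Complex.arg (fc (supportFn M') n / fc (supportFn M) n)) / n, fun k hk => ?_⟩
      by_cases hkn : k = n
      · have hn' : (n : ℂ) ≠ 0 := by
          have : n ≠ 0 := by omega
          exact_mod_cast this
        rw [hkn, ← div_eq_iff hn0]
        nth_rewrite 1 [← hexp]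
        congr 1
        push_cast
        field_simp
      · have hk0 : fc (supportFn M) k = 0 := by
          rcases lt_or_gt_of_ne hkn with hlt | hlt
          · by_contra hk1
            exact hn0 (hM k n hk hlt hk1)
          · exact hM n k hn hlt hn0
        rw [hk0, mul_zero, hzero k hk hk0]
    · push Not at hex
      refine ⟨0, fun k hk => ?_⟩
      rw [hex k hk, mul_zero, hzero k hk (hex k hk)]
  -- `b` is the mismatch left in the first coefficient after the rotation; `v` is the translation
  -- with that coefficient.
  set b : ℂ := fc (supportFn M') 1 - Complex.exp (-((1 : ℤ) * φ * Complex.I)) * fc (supportFn M) 1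
    with hb
  let v : Plane := !₂[2 * b.re, -(2 * b.im)]
  have hv : fc (fun θ => inner ℝ (unitVec θ) v) 1 = b := by
    simp only [inner_unitVec_eq_trigTerm]
    rw [show (fun θ => trigTerm _ 1 θ) = trigTerm ⟨v 0 / 2, -(v 1 / 2)⟩ 1 from rfl, fc_trigTerm]
    apply Complex.ext <;> simp [v]
    ring
  refine ⟨rotMat φ, rotMat_mem φ, v, ?_⟩
  rw [← coe_motion]
  refine coe_eq_of_supportFn_eq (supportFn_eq_of_fc_eq fun n hn => ?_)
  rw [show supportFn (M.motion (rotMat φ) v) = fun θ => supportFn M (θ - φ)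
    + inner ℝ (unitVec θ) v from funext fun θ => supportFn_motion M φ v θ, fc_rotate_add]
  obtain rfl | rfl | h2 : n = 0 ∨ n = 1 ∨ 2 ≤ n := by omega
  · rw [fc_inner_unitVec v (by norm_num) (by norm_num)]
    obtain ⟨r, hr, h1⟩ := exists_fc_zero_eq M
    obtain ⟨s, hs, h2⟩ := exists_fc_zero_eq M'
    have h3 := hnorm 0 (by norm_num) (by norm_num)
    rw [h1, h2, Complex.norm_real, Complex.norm_real, Real.norm_of_nonneg hr,
      Real.norm_of_nonneg hs] at h3
    rw [h1, h2, h3]; simp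
  · rw [hv, hb]; ring
  · rw [fc_inner_unitVec v (by omega) (by omega), add_zero, hφ n h2]

/-! ### Support functions of bodies with a regular boundary curve -/

lemma exists_pos_le_of_periodic {g : ℝ → ℝ} {L : ℝ} (hL : 0 < L) (hc : Continuous g)
    (hp : Function.Periodic g L) (hpos : ∀ t, 0 < g t) : ∃ δ, 0 < δ ∧ ∀ t, δ ≤ g t := by
  obtain ⟨t, -, ht⟩ := isCompact_Icc.exists_isMinOn (Set.nonempty_Icc.2 hL.le) hc.continuousOn
  refine ⟨g t, hpos t, fun s => ?_⟩
  obtain ⟨s', h1, h2⟩ := hp.exists_mem_Ico₀ hL s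
  rw [h2]
  exact ht (Set.Ico_subset_Icc_self h1)

/-- A positive second derivative would make the maximum also a local minimum, so `q` would be
locally constant. -/
lemma nonpos_of_forall_le {q q' : ℝ → ℝ} {c t : ℝ} (h1 : ∀ s, HasDerivAt q (q' s) s)
    (h2 : HasDerivAt q' c t) (hmax : ∀ s, q s ≤ q t) : c ≤ 0 := by
  by_contra! hc
  have hd : deriv q = q' := funext fun s => (h1 s).deriv
  have h0 : q' t = 0 := (show IsLocalMax q t from Filter.Eventually.of_forall hmax).hasDerivAt_eq_zero
    (h1 t)
  have hmin : IsLocalMin q t := isLocalMin_of_deriv_deriv_pos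
    (by rw [hd, h2.deriv]; exact hc) (by rw [hd, h0]) (h1 t).continuousAt
  have hev : q =ᶠ[nhds t] fun _ => q t := by
    filter_upwards [hmin] with s hs
    exact le_antisymm (hmax s) hs
  have h3 : deriv (deriv q) t = 0 := by rw [hev.deriv.deriv_eq]; simp
  rw [hd, h2.deriv] at h3
  exact hc.ne' h3

/-- A regular closed plane curve with positive curvature, in coordinates. -/
structure IsPosCurve (L : ℝ) (x x' x'' y y' y'' : ℝ → ℝ) : Prop where
  pos : 0 < L
  dx : ∀ t, HasDerivAt x (x' t) t
  dy : ∀ t, HasDerivAt y (y' t) t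
  dx' : ∀ t, HasDerivAt x' (x'' t) t
  dy' : ∀ t, HasDerivAt y' (y'' t) t
  cx : Continuous x''
  cy : Continuous y''
  px' : Function.Periodic x' L
  py' : Function.Periodic y' L
  px'' : Function.Periodic x'' L
  py'' : Function.Periodic y'' L
  curv : ∀ t, 0 < x' t * y'' t - y' t * x'' t

namespace IsPosCurve

variable {L : ℝ} {x x' x'' y y' y'' : ℝ → ℝ}

lemma cx' (H : IsPosCurve L x x' x'' y y' y'') : Continuous x' :=
  continuous_iff_continuousAt.2 fun t => (H.dx' t).continuousAt

lemma cy' (H : IsPosCurve L x x' x'' y y' y'') : Continuous y' :=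
  continuous_iff_continuousAt.2 fun t => (H.dy' t).continuousAt

lemma cx₀ (H : IsPosCurve L x x' x'' y y' y'') : Continuous x :=
  continuous_iff_continuousAt.2 fun t => (H.dx t).continuousAt

lemma cy₀ (H : IsPosCurve L x x' x'' y y' y'') : Continuous y :=
  continuous_iff_continuousAt.2 fun t => (H.dy t).continuousAt

lemma speed_sq_pos (H : IsPosCurve L x x' x'' y y' y'') (t : ℝ) : 0 < x' t ^ 2 + y' t ^ 2 := by
  have h := H.curv t
  by_contra! hle
  have h1 : x' t = 0 := by nlinarith [sq_nonneg (x' t), sq_nonneg (y' t)]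
  have h2 : y' t = 0 := by nlinarith [sq_nonneg (x' t), sq_nonneg (y' t)]
  rw [h1, h2] at h
  simp at h

/-- The tangent angle of the curve. -/
lemma exists_angle (H : IsPosCurve L x x' x'' y y' y'') :
    ∃ α : ℝ → ℝ, (∀ t, HasDerivAt α
        ((x' t * y'' t - y' t * x'' t) / (x' t ^ 2 + y' t ^ 2)) t) ∧
      (∀ t, x' t = √(x' t ^ 2 + y' t ^ 2) * Real.cos (α t)) ∧
      ∀ t, y' t = √(x' t ^ 2 + y' t ^ 2) * Real.sin (α t) := by
  have hcx := H.cx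
  have hcy := H.cy
  have hcx' := H.cx'
  have hcy' := H.cy'
  set w : ℝ → ℝ := fun t => (x' t * y'' t - y' t * x'' t) / (x' t ^ 2 + y' t ^ 2) with hw
  have hwc : Continuous w := by
    refine Continuous.div (by fun_prop) (by fun_prop) fun t => (H.speed_sq_pos t).ne'
  set r : ℝ → ℝ := fun t => √(x' t ^ 2 + y' t ^ 2) with hr
  have hrpos : ∀ t, 0 < r t := fun t => Real.sqrt_pos.2 (H.speed_sq_pos t)
  have hrsq : ∀ t, r t ^ 2 = x' t ^ 2 + y' t ^ 2 := fun t => Real.sq_sqrt (H.speed_sq_pos t).le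
  set z : ℂ := ⟨x' 0, y' 0⟩ with hz
  have hzn : ‖z‖ = r 0 := by rw [Complex.norm_eq_sqrt_sq_add_sq]
  -- The angle is defined by integrating the angular speed of the tangent. In the frame turned by
  -- `α` the unit tangent then has constant components, equal to their values at `0`.
  set α : ℝ → ℝ := fun t => z.arg + ∫ s in (0 : ℝ)..t, w s with hα
  have hα0 : α 0 = z.arg := by simp [hα]
  have hαd : ∀ t, HasDerivAt α (w t) t := fun t =>
    (intervalIntegral.integral_hasDerivAt_right (hwc.intervalIntegrable _ _)
      (hwc.stronglyMeasurableAtFilter _ _) hwc.continuousAt).const_add _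
  have hx0 : x' 0 = r 0 * Real.cos (α 0) := by
    rw [hα0, ← hzn, Complex.norm_mul_cos_arg]
  have hy0 : y' 0 = r 0 * Real.sin (α 0) := by
    rw [hα0, ← hzn, Complex.norm_mul_sin_arg]
  have hrd : ∀ t, HasDerivAt r ((x' t * x'' t + y' t * y'' t) / r t) t := by
    intro t
    convert! (((H.dx' t).pow 2).add ((H.dy' t).pow 2)).sqrt (H.speed_sq_pos t).ne' using 1
    have := (hrpos t).ne'
    simp only [hr] at this
    simp only [hr, Pi.add_apply, Pi.pow_apply]
    field_simp
    push_cast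
    ring
  have hPd : ∀ t, HasDerivAt (fun t => (x' t * Real.sin (α t) - y' t * Real.cos (α t)) / r t) 0 t := by
    intro t
    convert! ((((H.dx' t).mul (hαd t).sin).sub ((H.dy' t).mul (hαd t).cos))).div (hrd t)
      (hrpos t).ne' using 1
    have h1 := (hrpos t).ne'
    have h2 := hrsq t
    simp only [hw]
    rw [← h2]
    field_simp
    simp only [Pi.mul_apply, Pi.sub_apply]
    field_simp
    rw [h2]
    ring
  have hQd : ∀ t, HasDerivAt (fun t => (x' t * Real.cos (α t) + y' t * Real.sin (α t)) / r t) 0 t := by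
    intro t
    convert! ((((H.dx' t).mul (hαd t).cos).add ((H.dy' t).mul (hαd t).sin))).div (hrd t)
      (hrpos t).ne' using 1
    have h1 := (hrpos t).ne'
    have h2 := hrsq t
    simp only [hw]
    rw [← h2]
    field_simp
    simp only [Pi.mul_apply, Pi.add_apply]
    field_simp
    rw [h2]
    ring
  have hP : ∀ t, x' t * Real.sin (α t) - y' t * Real.cos (α t) = 0 := by
    intro t
    have h1 := is_const_of_deriv_eq_zero (fun t => (hPd t).differentiableAt)
      (fun t => (hPd t).deriv) t 0
    rw [hx0, hy0, div_eq_iff (hrpos t).ne'] at h1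
    rw [h1]; ring
  have hQ : ∀ t, x' t * Real.cos (α t) + y' t * Real.sin (α t) = r t := by
    intro t
    have h1 := is_const_of_deriv_eq_zero (fun t => (hQd t).differentiableAt)
      (fun t => (hQd t).deriv) t 0
    rw [hx0, hy0, div_eq_iff (hrpos t).ne'] at h1
    rw [h1]
    have := (hrpos 0).ne'
    field_simp
    rw [Real.cos_sq_add_sin_sq, one_mul]
  refine ⟨α, hαd, fun t => ?_, fun t => ?_⟩
  · change x' t = r t * _
    rw [← hQ t]
    linear_combination Real.sin (α t) * hP t - x' t * Real.sin_sq_add_cos_sq (α t)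
  · change y' t = r t * _
    rw [← hQ t]
    linear_combination -Real.cos (α t) * hP t - y' t * Real.sin_sq_add_cos_sq (α t)

/-- The support function of a convex body bounded by a curve of positive curvature is `C²` with
positive radius of curvature `h + h''`. -/
lemma supportFn_isPeriodicC2 (H : IsPosCurve L x x' x'' y y' y'') {M : ConvexBody Plane}
    (hmem : ∀ t, (!₂[x t, y t] : Plane) ∈ (M : Set Plane))
    (hsupp : ∀ t, ∃ v : Plane, v ≠ 0 ∧ ∀ p ∈ (M : Set Plane),
      v 0 * p 0 + v 1 * p 1 ≤ v 0 * x t + v 1 * y t) :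
    ∃ f' f'' : ℝ → ℝ, IsPeriodicC2 (supportFn M) f' f'' ∧
      ∃ δ, 0 < δ ∧ ∀ θ, δ ≤ supportFn M θ + f'' θ := by
  obtain ⟨α, hα, hxα, hyα⟩ := H.exists_angle
  have hcx := H.cx
  have hcy := H.cy
  have hcx' := H.cx'
  have hcy' := H.cy'
  have hcx0 := H.cx₀
  have hcy0 := H.cy₀
  set w : ℝ → ℝ := fun t => (x' t * y'' t - y' t * x'' t) / (x' t ^ 2 + y' t ^ 2) with hw
  set r : ℝ → ℝ := fun t => √(x' t ^ 2 + y' t ^ 2) with hr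
  have hrpos : ∀ t, 0 < r t := fun t => Real.sqrt_pos.2 (H.speed_sq_pos t)
  have hrc : Continuous r := by simp only [hr]; fun_prop
  have hwpos : ∀ t, 0 < w t := fun t => div_pos (H.curv t) (H.speed_sq_pos t)
  have hwc : Continuous w := by
    refine Continuous.div (by fun_prop) (by fun_prop) fun t => (H.speed_sq_pos t).ne'
  have hwp : Function.Periodic w L := fun t => by
    simp only [hw, H.px' t, H.py' t, H.px'' t, H.py'' t]
  have hrp : Function.Periodic r L := fun t => by simp only [hr, H.px' t, H.py' t]
  obtain ⟨c, hc, hcw⟩ := exists_pos_le_of_periodic H.pos hwc hwp hwpos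
  have hαc : Continuous α := continuous_iff_continuousAt.2 fun t => (hα t).continuousAt
  have hmono : StrictMono α := strictMono_of_deriv_pos fun t => by
    rw [(hα t).deriv]; exact hwpos t
  have hmono2 : Monotone fun t => α t - c * t := by
    have hd : ∀ t, HasDerivAt (fun t => α t - c * t) (w t - c) t := fun t => by
      have h := (hα t).sub ((hasDerivAt_id t).const_mul c)
      rw [mul_one] at h
      exact h
    exact monotone_of_deriv_nonneg (fun t => (hd t).differentiableAt) fun t => by
      rw [(hd t).deriv]; linarith [hcw t]
  have hlin : Filter.Tendsto (fun t : ℝ => c * t + α 0) Filter.atTop Filter.atTop :=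
    Filter.tendsto_atTop_add_const_right _ _ (Filter.tendsto_id.const_mul_atTop hc)
  have hlin2 : Filter.Tendsto (fun t : ℝ => c * t + α 0) Filter.atBot Filter.atBot :=
    Filter.tendsto_atBot_add_const_right _ _ (Filter.tendsto_id.const_mul_atBot hc)
  have hsurj : Function.Surjective α := by
    refine hαc.surjective (Filter.tendsto_atTop_mono' _ ?_ hlin)
      (Filter.tendsto_atBot_mono' _ ?_ hlin2)
    · filter_upwards [Filter.eventually_ge_atTop 0] with t ht
      have := hmono2 ht
      simp only at this
      linarith
    · filter_upwards [Filter.eventually_le_atBot 0] with t ht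
      have := hmono2 ht
      simp only at this
      linarith
  let e : ℝ ≃o ℝ := hmono.orderIsoOfSurjective α hsurj
  have he : ∀ s, α (e.symm s) = s := fun s => e.apply_symm_apply s
  have hed : ∀ s, HasDerivAt e.symm (w (e.symm s))⁻¹ s := fun s =>
    (hα (e.symm s)).of_local_left_inverse e.symm.continuous.continuousAt (hwpos _).ne'
      (Filter.Eventually.of_forall he)
  -- The tangent angle increases at a rate bounded below, so it is invertible on `ℝ`. `T θ` is the
  -- parameter with tangent angle `θ + π/2`, where the outer normal should be `u_θ`.
  let T : ℝ → ℝ := fun θ => e.symm (θ + Real.pi / 2)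
  have hTα : ∀ θ, α (T θ) = θ + Real.pi / 2 := fun θ => he _
  have hTd : ∀ θ, HasDerivAt T (w (T θ))⁻¹ θ := fun θ =>
    (hed (θ + Real.pi / 2)).comp_add_const θ (Real.pi / 2)
  have hTc : Continuous T := e.symm.continuous.comp (continuous_add_const _)
  have hxT : ∀ θ, x' (T θ) = -(r (T θ) * Real.sin θ) := fun θ => by
    rw [hxα, hTα, Real.cos_add_pi_div_two]; ring
  have hyT : ∀ θ, y' (T θ) = r (T θ) * Real.cos θ := fun θ => by
    rw [hyα, hTα, Real.sin_add_pi_div_two]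
  have hh : ∀ θ, supportFn M θ = Real.cos θ * x (T θ) + Real.sin θ * y (T θ) := by
    intro θ
    refine supportFn_eq_of_forall_le (hmem (T θ)) (by rw [inner_unitVec]; simp) fun p hp => ?_
    rw [inner_unitVec]
    -- The height along a supporting normal `v` is maximal on the curve at `T θ`. The first-order
    -- condition makes `v` a multiple `l u_θ`, and the second-order condition with positive
    -- curvature makes `l > 0`.
    obtain ⟨v, hv, hvp⟩ := hsupp (T θ)
    have hq1 : ∀ s, HasDerivAt (fun s => v 0 * x s + v 1 * y s) (v 0 * x' s + v 1 * y' s) s :=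
      fun s => ((H.dx s).const_mul _).add ((H.dy s).const_mul _)
    have hq2 : HasDerivAt (fun s => v 0 * x' s + v 1 * y' s)
        (v 0 * x'' (T θ) + v 1 * y'' (T θ)) (T θ) :=
      ((H.dx' _).const_mul _).add ((H.dy' _).const_mul _)
    have hmax : ∀ s, v 0 * x s + v 1 * y s ≤ v 0 * x (T θ) + v 1 * y (T θ) := fun s => by
      simpa using hvp _ (hmem s)
    have h2 := nonpos_of_forall_le hq1 hq2 hmax
    have h1 : v 0 * x' (T θ) + v 1 * y' (T θ) = 0 :=
      IsLocalMax.hasDerivAt_eq_zero (Filter.Eventually.of_forall hmax) (hq1 _)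
    have hD := H.curv (T θ)
    rw [hxT, hyT] at h1 hD
    have hrT := hrpos (T θ)
    have hsc := Real.sin_sq_add_cos_sq θ
    have h1' : v 1 * Real.cos θ = v 0 * Real.sin θ := by
      refine mul_left_cancel₀ hrT.ne' ?_
      linear_combination h1
    set l := v 0 * Real.cos θ + v 1 * Real.sin θ with hl
    have hv0 : v 0 = l * Real.cos θ := by
      rw [hl]; linear_combination -v 0 * hsc - Real.sin θ * h1'
    have hv1 : v 1 = l * Real.sin θ := by
      rw [hl]; linear_combination -v 1 * hsc + Real.cos θ * h1'
    have hl0 : l ≠ 0 := by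
      intro h0
      apply hv
      rw [h0, zero_mul] at hv0 hv1
      ext i; fin_cases i
      · exact hv0
      · exact hv1
    have hD' : Real.cos θ * x'' (T θ) + Real.sin θ * y'' (T θ) < 0 := by
      by_contra! hge
      have := mul_nonneg hrT.le hge
      linarith
    have hlpos : 0 < l := by
      refine lt_of_le_of_ne ?_ hl0.symm
      by_contra! hneg
      rw [hv0, hv1] at h2
      have := mul_pos_of_neg_of_neg hneg hD'
      linarith
    have h3 := hvp p hp
    rw [hv0, hv1] at h3
    refine le_of_mul_le_mul_left ?_ hlpos
    linarith
  have hd1 : ∀ θ, HasDerivAt (supportFn M)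
      (-Real.sin θ * x (T θ) + Real.cos θ * y (T θ)) θ := by
    intro θ
    rw [show supportFn M = fun θ => Real.cos θ * x (T θ) + Real.sin θ * y (T θ) from funext hh]
    have h1 := (H.dx (T θ)).comp θ (hTd θ)
    have h2 := (H.dy (T θ)).comp θ (hTd θ)
    convert! ((Real.hasDerivAt_cos θ).mul h1).add ((Real.hasDerivAt_sin θ).mul h2) using 1
    -- The terms from differentiating the contact point cancel, since the tangent is orthogonal to
    -- `u_θ`.
    rw [hxT, hyT]
    simp only [Function.comp]
    ring
  have hd2 : ∀ θ, HasDerivAt (fun θ => -Real.sin θ * x (T θ) + Real.cos θ * y (T θ))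
      (r (T θ) * (w (T θ))⁻¹ - supportFn M θ) θ := by
    intro θ
    have h1 := (H.dx (T θ)).comp θ (hTd θ)
    have h2 := (H.dy (T θ)).comp θ (hTd θ)
    convert! ((Real.hasDerivAt_sin θ).neg.mul h1).add ((Real.hasDerivAt_cos θ).mul h2) using 1
    rw [hxT, hyT, hh]
    simp only [Function.comp, Pi.neg_apply]
    linear_combination -(r (T θ) * (w (T θ))⁻¹) * Real.sin_sq_add_cos_sq θ
  have hwi : Continuous fun t => r t * (w t)⁻¹ := hrc.mul (hwc.inv₀ fun t => (hwpos t).ne')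
  obtain ⟨δ, hδ, hδr⟩ := exists_pos_le_of_periodic (g := fun t => r t * (w t)⁻¹) H.pos hwi
    (fun t => by simp only [hrp t, hwp t])
    (fun t => mul_pos (hrpos t) (inv_pos.2 (hwpos t)))
  refine ⟨_, _, ⟨hd1, hd2, (hwi.comp hTc).sub (continuous_supportFn M), periodic_supportFn M⟩,
    δ, hδ, fun θ => ?_⟩
  have := hδr (T θ)
  linarith

end IsPosCurve

lemma exists_support_of_mem_frontier {M : ConvexBody Plane} (hne : (interior (M : Set Plane)).Nonempty)
    {q : Plane} (hq : q ∈ frontier (M : Set Plane)) :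
    ∃ v : Plane, v ≠ 0 ∧ ∀ p ∈ (M : Set Plane), v 0 * p 0 + v 1 * p 1 ≤ v 0 * q 0 + v 1 * q 1 := by
  obtain ⟨f, hf⟩ := geometric_hahn_banach_open_point M.convex.interior isOpen_interior hq.2
  obtain ⟨v, rfl⟩ := (InnerProductSpace.toDual ℝ Plane).surjective f
  have hin : ∀ p : Plane, (InnerProductSpace.toDual ℝ Plane v) p = v 0 * p 0 + v 1 * p 1 := by
    intro p
    rw [InnerProductSpace.toDual_apply_apply]
    simp [PiLp.inner_apply, Fin.sum_univ_two]; ring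
  refine ⟨v, ?_, fun p hp => ?_⟩
  · rintro rfl
    obtain ⟨a, ha⟩ := hne
    simpa using hf a ha
  · have hcl : p ∈ closure (interior (M : Set Plane)) := by
      rw [M.convex.closure_interior_eq_closure_of_nonempty_interior hne]
      exact subset_closure hp
    have hclosed : IsClosed {p : Plane | (InnerProductSpace.toDual ℝ Plane v) p
        ≤ (InnerProductSpace.toDual ℝ Plane v) q} :=
      isClosed_le (by fun_prop) continuous_const
    have := closure_minimal (fun a ha => (hf a ha).le) hclosed hcl
    simpa only [hin] using! this

/-- The support function of a `C²₊` body is `C²` with `h + h''` bounded below by a positive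
constant. -/
lemma IsC2Plus.supportFn_isPeriodicC2 {M : ConvexBody Plane} (hM : IsC2Plus M) :
    ∃ f' f'' : ℝ → ℝ, IsPeriodicC2 (supportFn M) f' f'' ∧
      ∃ δ, 0 < δ ∧ ∀ θ, δ ≤ supportFn M θ + f'' θ := by
  obtain ⟨hsc, L, γ, hL, hγ, hper, -, hrange, hreg, hcurv⟩ := hM
  have hγ' : ContDiff ℝ 1 (deriv γ) := hγ.deriv'
  have hd : ∀ t, HasDerivAt γ (deriv γ t) t := fun t =>
    (hγ.differentiable two_ne_zero t).hasDerivAt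
  have hd' : ∀ t, HasDerivAt (deriv γ) (deriv (deriv γ) t) t := fun t =>
    (hγ'.differentiable one_ne_zero t).hasDerivAt
  have hc'' : Continuous (deriv (deriv γ)) := hγ'.continuous_deriv le_rfl
  have hp' : Function.Periodic (deriv γ) L := fun t => by
    have h := (hd (t + L)).comp_add_const t L
    simp only [hper _] at h
    exact h.unique (hd t)
  have hp'' : Function.Periodic (deriv (deriv γ)) L := fun t => by
    have h := (hd' (t + L)).comp_add_const t L
    simp only [hp' _] at h
    exact h.unique (hd' t)
  have hcoord : ∀ {g : ℝ → Plane} {g' : Plane} {t : ℝ} (i : Fin 2), HasDerivAt g g' t →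
      HasDerivAt (fun s => g s i) (g' i) t := fun i h =>
    (EuclideanSpace.proj (𝕜 := ℝ) i).hasFDerivAt.comp_hasDerivAt _ h
  have hfr : ∀ t, γ t ∈ frontier (M : Set Plane) := fun t => hrange ▸ Set.mem_range_self t
  have hmem : ∀ t, γ t ∈ (M : Set Plane) := fun t => M.isClosed.frontier_subset (hfr t)
  -- A regular curve is not constant, and strict convexity puts the midpoint of two distinct points
  -- in the interior.
  have hne : (interior (M : Set Plane)).Nonempty := by
    have : ∃ t, γ t ≠ γ 0 := by
      by_contra! hconst
      apply hreg 0
      rw [show γ = fun _ => γ 0 from funext hconst]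
      simp
    obtain ⟨t, ht⟩ := this
    exact ⟨_, hsc (hmem t) (hmem 0) ht (a := 1 / 2) (b := 1 / 2) (by norm_num) (by norm_num)
      (by norm_num)⟩
  have hsupp := fun t => exists_support_of_mem_frontier hne (hfr t)
  set D : ℝ → ℝ := fun t => deriv γ t 0 * deriv (deriv γ) t 1 - deriv γ t 1 * deriv (deriv γ) t 0
    with hD
  have hD0 : ∀ t, D t ≠ 0 := fun t h => hcurv t (by rw [signedCurvature]; simp only [hD] at h; simp [h])
  have hc' : Continuous (deriv γ) := hγ'.continuous
  have hDc : Continuous D := by simp only [hD]; fun_prop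
  have heta : ∀ t, (!₂[γ t 0, γ t 1] : Plane) = γ t := fun t => by
    ext i; fin_cases i <;> rfl
  -- The nonvanishing curvature has constant sign by the intermediate value theorem; a negative sign
  -- is removed by reversing the parametrization.
  have hsign : (∀ t, 0 < D t) ∨ ∀ t, D t < 0 := by
    rcases lt_or_gt_of_ne (hD0 0) with h | h
    · right
      intro t
      by_contra! hge
      obtain ⟨s, hs⟩ := mem_range_of_exists_le_of_exists_ge hDc ⟨0, h.le⟩ ⟨t, hge⟩
      exact hD0 s hs
    · left
      intro t
      by_contra! hge
      obtain ⟨s, hs⟩ := mem_range_of_exists_le_of_exists_ge hDc ⟨t, hge⟩ ⟨0, h.le⟩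
      exact hD0 s hs
  rcases hsign with hpos | hneg
  · have H : IsPosCurve L (fun t => γ t 0) (fun t => deriv γ t 0) (fun t => deriv (deriv γ) t 0)
        (fun t => γ t 1) (fun t => deriv γ t 1) (fun t => deriv (deriv γ) t 1) :=
      { pos := hL
        dx := fun t => hcoord 0 (hd t)
        dy := fun t => hcoord 1 (hd t)
        dx' := fun t => hcoord 0 (hd' t)
        dy' := fun t => hcoord 1 (hd' t)
        cx := by fun_prop
        cy := by fun_prop
        px' := fun t => by simp only [hp' t]
        py' := fun t => by simp only [hp' t]
        px'' := fun t => by simp only [hp'' t]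
        py'' := fun t => by simp only [hp'' t]
        curv := hpos }
    exact H.supportFn_isPeriodicC2 (fun t => (heta t).symm ▸ hmem t) hsupp
  · have hrev : ∀ {g g' : ℝ → ℝ}, (∀ t, HasDerivAt g (g' t) t) →
        ∀ t, HasDerivAt (fun s => g (-s)) (-g' (-t)) t := fun h t => by
      convert! (h (-t)).scomp t (hasDerivAt_neg t) using 1; simp
    have hrevp : ∀ {g : ℝ → Plane}, Function.Periodic g L →
        Function.Periodic (fun t => g (-t)) L := fun h t => by
      simpa only [neg_add, ← sub_eq_add_neg] using h.sub_eq (-t)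
    have hrd := fun i => hrev fun t => hcoord i (hd t)
    have hrd' : ∀ i, ∀ t, HasDerivAt (fun s => -(deriv γ (-s) i)) (deriv (deriv γ) (-t) i) t :=
      fun i t => by
        have h := ((hrev fun t => hcoord i (hd' t)) t).neg
        rw [neg_neg] at h
        exact h
    have H : IsPosCurve L (fun t => γ (-t) 0) (fun t => -(deriv γ (-t) 0))
        (fun t => deriv (deriv γ) (-t) 0) (fun t => γ (-t) 1) (fun t => -(deriv γ (-t) 1))
        (fun t => deriv (deriv γ) (-t) 1) :=
      { pos := hL
        dx := hrd 0
        dy := hrd 1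
        dx' := hrd' 0
        dy' := hrd' 1
        cx := by fun_prop
        cy := by fun_prop
        px' := fun t => by simp only [hrevp hp' t]
        py' := fun t => by simp only [hrevp hp' t]
        px'' := fun t => by simp only [hrevp hp'' t]
        py'' := fun t => by simp only [hrevp hp'' t]
        curv := fun t => by have := hneg (-t); simp only [hD] at this; linarith }
    exact H.supportFn_isPeriodicC2 (fun t => (heta (-t)).symm ▸ hmem (-t)) fun t => hsupp (-t)

/-! ### Bodies with the same excluded area that are not congruent -/

/-- A small rotation of one Fourier coefficient of a support function with `h + h'' ≥ δ > 0`
yields a support function. -/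
lemma exists_perturbed_body {M : ConvexBody Plane} {f' f'' : ℝ → ℝ} {δ : ℝ}
    (H : IsPeriodicC2 (supportFn M) f' f'') (hδ : ∀ θ, δ ≤ supportFn M θ + f'' θ) {n : ℤ}
    {b : ℂ} (hb : 2 * ‖b‖ * (n : ℝ) ^ 2 ≤ δ - 2 * ‖b‖) :
    ∃ M' : ConvexBody Plane, ∀ j, fc (supportFn M') j = fc (supportFn M) j +
      ((if j = n then b else 0) + (if j = -n then (starRingEnd ℂ) b else 0)) := by
  have H2 := H.add (isPeriodicC2_trigTerm b n)
  have habs : ∀ θ, |trigTerm b n θ| ≤ 2 * ‖b‖ := by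
    intro θ
    rw [trigTerm, abs_mul, abs_two]
    refine mul_le_mul_of_nonneg_left ((Complex.abs_re_le_norm _).trans ?_) two_pos.le
    rw [norm_mul, show ((n : ℂ) * θ) = ((n * θ : ℝ) : ℂ) by push_cast; ring,
      Complex.norm_exp_ofReal_mul_I, mul_one]
  -- The perturbation changes `h + h''` by `(1 - n²)` times a function bounded by `2‖b‖`, which the
  -- assumption on `b` keeps within `δ`.
  obtain ⟨M', hM'⟩ := H2.exists_supportFn_eq fun θ => by
    have h1 := abs_le.1 (habs θ)
    have h2 := hδ θ
    have h3 := mul_le_mul_of_nonneg_left h1.2 (sq_nonneg (n : ℝ))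
    linarith [h1.1]
  refine ⟨M', fun j => ?_⟩
  rw [hM', fc_add (continuous_supportFn M) (continuous_trigTerm b n), fc_trigTerm]

/-- If two Fourier coefficients of index at least `2` are nonzero, there is a noncongruent convex
body with the same excluded area. -/
lemma exists_not_isCongruentTo {M : ConvexBody Plane} (hM : IsC2Plus M) {m n : ℤ} (hm : 2 ≤ m)
    (hmn : m < n) (hcm : fc (supportFn M) m ≠ 0) (hcn : fc (supportFn M) n ≠ 0) :
    ∃ M' : ConvexBody Plane, ¬ IsCongruentTo M' M ∧ excludedArea M = excludedArea M' := by
  obtain ⟨f', f'', H, δ, hδ, hδh⟩ := hM.supportFn_isPeriodicC2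
  set c := fc (supportFn M) with hc
  have hbody : ∀ᶠ ε : ℝ in nhds 0, ∃ M' : ConvexBody Plane,
      fc (supportFn M') m = c m ∧ fc (supportFn M') n = Complex.exp (ε * Complex.I) * c n ∧
      excludedArea M = excludedArea M' := by
    have hlim : Filter.Tendsto (fun ε : ℝ => 2 * ‖(Complex.exp (ε * Complex.I) - 1) * c n‖ *
        (n : ℝ) ^ 2 + 2 * ‖(Complex.exp (ε * Complex.I) - 1) * c n‖) (nhds 0) (nhds 0) := by
      refine Continuous.tendsto' (by fun_prop) _ _ ?_
      simp
    filter_upwards [hlim.eventually_lt_const hδ] with ε hε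
    -- This `b` turns `c n` into `e^{iε} c n`, preserving all moduli, and tends to `0` with `ε`.
    obtain ⟨M', hM'⟩ := exists_perturbed_body (n := n)
      (b := (Complex.exp (ε * Complex.I) - 1) * c n) H hδh (by linarith)
    have h1 : fc (supportFn M') n = Complex.exp (ε * Complex.I) * c n := by
      rw [hM', if_pos rfl, if_neg (by omega)]; ring
    refine ⟨M', ?_, h1, ?_⟩
    · rw [hM', if_neg (by omega), if_neg (by omega)]; simp [hc]
    · refine excludedArea_eq_of_norm_fc_eq fun j _ _ => ?_
      have h2 : ‖fc (supportFn M') n‖ = ‖c n‖ := by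
        rw [h1, norm_mul, Complex.norm_exp_ofReal_mul_I, one_mul]
      by_cases hj : j = n
      · rw [hj, h2]
      by_cases hj2 : j = -n
      · rw [hj2, norm_fc_neg, norm_fc_neg, h2]
      · rw [hM', if_neg hj, if_neg hj2]; simp
  -- Eliminating `φ` from the relations at `m` and `n` by taking powers `n` and `m` gives `e^{iεm} =
  -- 1` for a rotation and `e^{iεm} = w` for a reflection.
  set w : ℂ := ((starRingEnd ℂ) (c n) / c n) ^ m * (c m / (starRingEnd ℂ) (c m)) ^ n with hw
  have hcong : ∀ (ε : ℝ) (M' : ConvexBody Plane), fc (supportFn M') m = c m →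
      fc (supportFn M') n = Complex.exp (ε * Complex.I) * c n → IsCongruentTo M' M →
      Complex.exp (ε * Complex.I) ^ m = 1 ∨ Complex.exp (ε * Complex.I) ^ m = w := by
    intro ε M' h1 h2 h
    obtain ⟨φ, h | h⟩ := fc_of_isCongruentTo h
    · left
      have e1 := h m (by omega) (by omega)
      have e2 := h n (by omega) (by omega)
      rw [h1, eq_comm, mul_eq_right₀ hcm] at e1
      rw [h2] at e2
      rw [mul_right_cancel₀ hcn e2, ← Complex.exp_int_mul]
      rw [show (m : ℂ) * -(n * φ * Complex.I) = n * -(m * φ * Complex.I) by ring,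
        Complex.exp_int_mul, e1, one_zpow]
    · right
      have e1 := h m (by omega) (by omega)
      have e2 := h n (by omega) (by omega)
      rw [h1] at e1
      rw [h2] at e2
      have hcm' : (starRingEnd ℂ) (c m) ≠ 0 := (map_ne_zero _).2 hcm
      have e3 : Complex.exp (ε * Complex.I)
          = (starRingEnd ℂ) (c n) / c n * Complex.exp (-(n * φ * Complex.I)) := by
        rw [div_mul_eq_mul_div, eq_div_iff hcn, e2, mul_comm]
      have e4 : c m / (starRingEnd ℂ) (c m) = Complex.exp (-(m * φ * Complex.I)) := by
        rw [div_eq_iff hcm', ← e1]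
      rw [hw, e3, e4, mul_zpow, ← Complex.exp_int_mul, ← Complex.exp_int_mul]
      congr 2
      ring
  obtain ⟨η, hη, hball⟩ := Metric.eventually_nhds_iff.1 hbody
  have hmR : (2 : ℝ) ≤ m := by exact_mod_cast hm
  have hgood : ∃ ε : ℝ, |ε| < η ∧ Complex.exp (ε * Complex.I) ^ m ≠ 1 ∧
      Complex.exp (ε * Complex.I) ^ m ≠ w := by
    have hinj : ∀ s t : ℝ, 0 ≤ s → s < t → t * m < 2 * Real.pi →
        Complex.exp (s * Complex.I) ^ m ≠ Complex.exp (t * Complex.I) ^ m := by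
      intro s t hs hst ht h
      rw [← Complex.exp_int_mul, ← Complex.exp_int_mul, Complex.exp_eq_exp_iff_exists_int] at h
      obtain ⟨k, hk⟩ := h
      have hk2 : (m : ℝ) * s = m * t + k * (2 * Real.pi) := by
        have h3 : ((m * s : ℝ) : ℂ) * Complex.I = ((m * t + k * (2 * Real.pi) : ℝ) : ℂ) * Complex.I := by
          push_cast; linear_combination hk
        exact_mod_cast mul_right_cancel₀ Complex.I_ne_zero h3
      have hpi := Real.two_pi_pos
      have h4 : (k : ℝ) * (2 * Real.pi) < 0 := by nlinarith
      have h5 : -(1 : ℝ) * (2 * Real.pi) < k * (2 * Real.pi) := by nlinarith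
      have h6 : (k : ℝ) < 0 := by
        by_contra! h7; nlinarith
      have h7 : -(1 : ℝ) < k := lt_of_mul_lt_mul_right h5 hpi.le
      have h8 : k < 0 := by exact_mod_cast h6
      have h9 : -1 < k := by exact_mod_cast h7
      omega
    -- Since `t m < 2π`, the `m`-th powers for the angles `0`, `t/2`, `t` are distinct. Neither of
    -- the last two is `1`, and at most one of them equals `w`.
    set t := min (η / 2) (1 / m) with ht
    have hm0 : (0 : ℝ) < m := by linarith
    have htpos : 0 < t := lt_min (half_pos hη) (by positivity)
    have htη : t < η := (min_le_left _ _).trans_lt (half_lt_self hη)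
    have htm : t * m < 2 * Real.pi := by
      have h1 : t * m ≤ 1 := by
        have := mul_le_mul_of_nonneg_right (min_le_right (η / 2) (1 / (m : ℝ))) hm0.le
        rwa [one_div_mul_cancel hm0.ne'] at this
      linarith [Real.pi_gt_three]
    have htm2 : t / 2 * m < 2 * Real.pi := by nlinarith
    have h0 : Complex.exp ((0 : ℝ) * Complex.I) ^ m = 1 := by simp
    have a1 := hinj 0 t le_rfl htpos htm
    have a2 := hinj 0 (t / 2) le_rfl (half_pos htpos) htm2
    have a3 := hinj (t / 2) t (half_pos htpos).le (half_lt_self htpos) htm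
    rw [h0] at a1 a2
    by_cases hw1 : Complex.exp (t * Complex.I) ^ m = w
    · refine ⟨t / 2, ?_, a2.symm, fun h => a3 (h.trans hw1.symm)⟩
      rw [abs_of_pos (half_pos htpos)]; linarith
    · exact ⟨t, by rwa [abs_of_pos htpos], a1.symm, hw1⟩
  obtain ⟨ε, hεη, hε1, hεw⟩ := hgood
  obtain ⟨M', h1, h2, h3⟩ := hball (by rwa [Real.dist_eq, sub_zero] : dist ε 0 < η)
  exact ⟨M', fun h => (hcong ε M' h1 h2 h).elim hε1 hεw, h3⟩

lemma IsRigidMotionOf.isCongruentTo {M M' : ConvexBody Plane} (h : IsRigidMotionOf M' M) :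
    IsCongruentTo M' M := by
  obtain ⟨R, hR, v, hv⟩ := h
  exact ⟨R, (Matrix.mem_specialOrthogonalGroup_iff.1 hR).1, v, hv⟩

lemma exists_two_coeff_ne_zero {M M' : ConvexBody Plane} (hne : ¬ IsRigidMotionOf M' M)
    (h : excludedArea M = excludedArea M') :
    ∃ m n : ℤ, 2 ≤ m ∧ m < n ∧ supportCoeff M m ≠ 0 ∧ supportCoeff M n ≠ 0 := by
  by_contra! hcon
  exact hne (isRigidMotionOf_of_excludedArea_eq h hcon)

theorem mainTheorem1 :
    (∀ M M' : ConvexBody Plane, IsC2Plus M → IsC2Plus M' →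
      (excludedArea M = excludedArea M' ↔
        ∀ n : ℤ, n ≠ 1 → n ≠ -1 → ‖supportCoeff M n‖ = ‖supportCoeff M' n‖)) ∧
    (∀ M : ConvexBody Plane, IsC2Plus M →
      ((∃ M' : ConvexBody Plane, ¬ IsRigidMotionOf M' M ∧ excludedArea M = excludedArea M') ↔
        ∃ m n : ℤ, 2 ≤ m ∧ m < n ∧ supportCoeff M m ≠ 0 ∧ supportCoeff M n ≠ 0)) ∧
    (∀ M : ConvexBody Plane, IsC2Plus M →
      ((∃ M' : ConvexBody Plane, ¬ IsCongruentTo M' M ∧ excludedArea M = excludedArea M') ↔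
        ∃ m n : ℤ, 2 ≤ m ∧ m < n ∧ supportCoeff M m ≠ 0 ∧ supportCoeff M n ≠ 0)) := by
  refine ⟨fun M M' _ _ => ⟨fun h n h1 h2 => norm_fc_eq_of_excludedArea_eq h h1 h2,
    excludedArea_eq_of_norm_fc_eq⟩, fun M hM => ⟨?_, ?_⟩, fun M hM => ⟨?_, ?_⟩⟩
  · rintro ⟨M', hne, h⟩
    exact exists_two_coeff_ne_zero hne h
  · rintro ⟨m, n, hm, hmn, hcm, hcn⟩
    obtain ⟨M', hne, h⟩ := exists_not_isCongruentTo hM hm hmn hcm hcn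
    exact ⟨M', fun hr => hne hr.isCongruentTo, h⟩
  · rintro ⟨M', hne, h⟩
    exact exists_two_coeff_ne_zero (fun hr => hne hr.isCongruentTo) h
  · rintro ⟨m, n, hm, hmn, hcm, hcn⟩
    exact exists_not_isCongruentTo hM hm hmn hcm hcn
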